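/- \textbf{Iterated birational rowmotion formula.} Let $r,s\ge 1$ and let $R=[r]\times[s]$ be the product of the chains $1<\dots<r$ and $1<\dots<s$ with the componentwise order. All labelings are elements of $\mathbb R_{>0}^R$, and $q\lessdot p$ means that $p$ covers $q$. The \emph{birational transfer map} is the bijection $\phi:\mathbb R_{>0}^R\to\mathbb R_{>0}^R$, $\phi(x)_p = x_p/\sum_{q\lessdot p}x_q$ (an empty sum is read as $1$). The \emph{birational toggle} $t_p$ replaces the label $x_p$ by $$\Big(\sum_{q\gtrdot p}x_q^{-1}\Big)^{-1}\Big(\sum_{q\lessdot p}x_q\Big)\frac1{x_p}$$ and fixes all other labels, where the first factor is read as $1$ if nothing covers $p$, and the second as $1$ if $p$ covers nothing. \emph{Birational rowmotion} is $\rho=t_{L^{-1}(1)}\circ\cdots\circ t_{L^{-1}(rs)}$, where $L:R\to[rs]$ is any linear extension of $R$. For a labeling $x$, let $\mathcal G_R$ be the directed graph with vertex set $[r+1]\times[s]$, edges $(i,j)\to(i+1,j)$ of weight $x_{ij}^{-1}$, and edges $(i,j)\to(i+1,j-1)$ of weight $1$. For $1\le i\le r$, $1\le j\le s$ put $P_j=(1,j)$,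 $P_{s+i}=(i+1,s)$, $Q_i=(i,1)$, $Q_{r+j}=(r+1,j)$. Let $W^{(k)}_{ij}=W^{(k)}_{ij}(x)$ be the sum, over all collections of $k$ pairwise vertex-disjoint directed paths in $\mathcal G_R$ starting from $\{P_i,\dots,P_{i+k-1}\}$ and ending at $\{Q_j,\dots,Q_{j+k-1}\}$, of the product of the weights of all edges in the paths; so $W^{(0)}_{ij}=1$, and for $k\ge1$ we set $W^{(k)}_{ij}=0$ if one of the indices $i,\dots,i+k-1,j,\dots,j+k-1$ is not in $[r+s]$. Let $x\in\mathbb R_{>0}^R$ and $y=\phi^{-1}(x)$. Then $W$ is the array of solid minors of the matrix $\big(W^{(1)}_{ij}\big)$, that is, $W^{(k)}_{ij}=\det\big(W^{(1)}_{i+a,\,j+b}\big)_{0\le a,b<k}$, and it satisfies the octahedron recurrence $$W^{(k)}_{ij}W^{(k)}_{i+1,j+1}=W^{(k)}_{i,j+1}W^{(k)}_{i+1,j}+W^{(k+1)}_{ij}W^{(k-1)}_{i+1,j+1}\qquad(k\ge1,\ i,j\ge0).$$ Moreover, for every $(i,j)\in R$: (a) If $0\le k\le r+s-i-j$, then $$\rho^{-k}(y)_{ij}=\frac{W^{(j-1)}_{k+2,\,i+k+1}}{W^{(j)}_{k+1,\,i+k+1}}.$$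 (b) For all $k\in\mathbb Z$, $$\rho^k(y)_{ij}=\frac1{\rho^{k-i-j+1}(y)_{r+1-i,\,s+1-j}}.$$ In particular, if $0<k<i+j$, the right-hand side is given by (a): $$\rho^k(y)_{ij}=\left(\frac{W^{(s-j)}_{i+j-k+1,\;r+j+1-k}}{W^{(s+1-j)}_{i+j-k,\;r+j+1-k}}\right)^{-1}.$$ (c) For all $k\in\mathbb Z$, $\rho^{k+r+s}(y)=\rho^k(y)$; the order of $\rho$, as a permutation of $\mathbb R_{>0}^R$, is exactly $r+s$. -/

import Mathlib

open Finset

noncomputable section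

namespace BiRow

/-! ### Labelings of a finite poset, toggles and birational rowmotion -/

/-- Positive real labelings of `P`. -/
abbrev Labeling (P : Type*) : Type _ := {x : P → ℝ // ∀ p, 0 < x p}

/-- Sum over a finite set, where the empty sum is interpreted as `1`. -/
def sumOne {P : Type*} (S : Finset P) (f : P → ℝ) : ℝ :=
  open Classical in if S = ∅ then 1 else ∑ q ∈ S, f q

/-- Parallel sum `(∑ 1 / f q)⁻¹` over a finite set, where the empty parallel sum is
interpreted as `1`. -/
def parSumOne {P : Type*} (S : Finset P) (f : P → ℝ) : ℝ :=
  open Classical in if S = ∅ then 1 else (∑ q ∈ S, (f q)⁻¹)⁻¹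

theorem sumOne_pos {P : Type*} (S : Finset P) {f : P → ℝ} (hf : ∀ q, 0 < f q) :
    0 < sumOne S f := by
  unfold sumOne
  split_ifs with h
  · exact one_pos
  · exact Finset.sum_pos (fun q _ => hf q) (Finset.nonempty_iff_ne_empty.2 h)

theorem parSumOne_pos {P : Type*} (S : Finset P) {f : P → ℝ} (hf : ∀ q, 0 < f q) :
    0 < parSumOne S f := by
  unfold parSumOne
  split_ifs with h
  · exact one_pos
  · exact inv_pos.2 (Finset.sum_pos (fun q _ => inv_pos.2 (hf q))
      (Finset.nonempty_iff_ne_empty.2 h))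

theorem sumOne_congr {P : Type*} {S : Finset P} {f g : P → ℝ} (h : ∀ q ∈ S, f q = g q) :
    sumOne S f = sumOne S g := by
  unfold sumOne
  rw [Finset.sum_congr rfl h]

theorem parSumOne_congr {P : Type*} {S : Finset P} {f g : P → ℝ} (h : ∀ q ∈ S, f q = g q) :
    parSumOne S f = parSumOne S g := by
  unfold parSumOne
  rw [Finset.sum_congr rfl (fun q hq => by rw [h q hq])]

section Poset

variable {P : Type*} [PartialOrder P] [Fintype P]

/-- The elements covered by `p`. -/
def lowerCovers (p : P) : Finset P :=
  open Classical in Finset.univ.filter (fun q => q ⋖ p)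

/-- The elements covering `p`. -/
def upperCovers (p : P) : Finset P :=
  open Classical in Finset.univ.filter (fun q => p ⋖ q)

theorem mem_lowerCovers {p q : P} : q ∈ lowerCovers p ↔ q ⋖ p := by
  simp [lowerCovers]

theorem mem_upperCovers {p q : P} : q ∈ upperCovers p ↔ p ⋖ q := by
  simp [upperCovers]

/-- The birational transfer map `φ(x)_p = x_p / ∑_{q ⋖ p} x_q`, as a map. -/
def transferFun (x : Labeling P) : Labeling P :=
  ⟨fun p => x.val p / sumOne (lowerCovers p) x.val,
    fun p => div_pos (x.2 p) (sumOne_pos _ x.2)⟩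

theorem transferFun_bijective : Function.Bijective (transferFun (P := P)) := by
  constructor
  · intro x y hxy
    have hwf : WellFounded ((· < ·) : P → P → Prop) := wellFounded_lt
    apply Subtype.ext
    funext p
    induction p using hwf.induction with
    | _ p ih =>
      have h1 : x.val p / sumOne (lowerCovers p) x.val
          = y.val p / sumOne (lowerCovers p) y.val :=
        congrFun (congrArg Subtype.val hxy) p
      have h2 : sumOne (lowerCovers p) x.val = sumOne (lowerCovers p) y.val :=
        sumOne_congr (fun q hq => ih q (mem_lowerCovers.1 hq).lt)
      rw [h2] at h1
      exact (div_left_inj' (sumOne_pos _ y.2).ne').1 h1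
  · intro x
    have hwf : WellFounded ((· < ·) : P → P → Prop) := wellFounded_lt
    let F : (p : P) → ((q : P) → q < p → {t : ℝ // 0 < t}) → {t : ℝ // 0 < t} :=
      fun p rec => ⟨x.val p * sumOne (lowerCovers p)
          (fun q => open Classical in if h : q < p then (rec q h).val else 1),
        mul_pos (x.2 p) (sumOne_pos _ (fun q => by
          split_ifs with h
          · exact (rec q h).2
          · exact one_pos))⟩
    let y : Labeling P := ⟨fun p => (hwf.fix F p).val, fun p => (hwf.fix F p).2⟩
    refine ⟨y, ?_⟩
    apply Subtype.ext
    funext p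
    have hy : y.val p = x.val p * sumOne (lowerCovers p) y.val := by
      change (hwf.fix F p).val = _
      rw [hwf.fix_eq]
      change x.val p * sumOne _ _ = _
      congr 1
      apply sumOne_congr
      intro q hq
      rw [dif_pos (mem_lowerCovers.1 hq).lt]
    change y.val p / sumOne (lowerCovers p) y.val = x.val p
    rw [hy]
    exact mul_div_cancel_right₀ _ (sumOne_pos _ y.2).ne'

/-- The birational transfer map `φ`, as a bijection of the positive labelings. -/
def transfer : Labeling P ≃ Labeling P :=
  Equiv.ofBijective transferFun transferFun_bijective

/-- The birational toggle at `p`, as a map: it changes the label `x_p` to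
`(parallel sum of the labels covering p) * (sum of the labels covered by p) / x_p`
and fixes all other labels. -/
def toggleFun (p : P) (x : Labeling P) : Labeling P :=
  open Classical in
  ⟨Function.update x.val p
      (parSumOne (upperCovers p) x.val * sumOne (lowerCovers p) x.val * (x.val p)⁻¹),
    fun q => by
      classical
      by_cases h : q = p
      · subst h
        simpa using mul_pos (mul_pos (parSumOne_pos _ x.2) (sumOne_pos _ x.2))
          (inv_pos.2 (x.2 q))
      · simpa [Function.update_of_ne h] using x.2 q⟩

theorem toggleFun_involutive (p : P) : Function.Involutive (toggleFun p) := by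
  classical
  intro x
  have hne : ∀ q, q ≠ p → (toggleFun p x).val q = x.val q := fun q h => by
    simp [toggleFun, Function.update_of_ne h]
  have hp : (toggleFun p x).val p =
      parSumOne (upperCovers p) x.val * sumOne (lowerCovers p) x.val * (x.val p)⁻¹ := by
    simp [toggleFun]
  apply Subtype.ext
  funext q
  by_cases h : q = p
  · subst h
    have e1 : parSumOne (upperCovers q) (toggleFun q x).val
        = parSumOne (upperCovers q) x.val :=
      parSumOne_congr (fun t ht => hne t (mem_upperCovers.1 ht).lt.ne')
    have e2 : sumOne (lowerCovers q) (toggleFun q x).val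
        = sumOne (lowerCovers q) x.val :=
      sumOne_congr (fun t ht => hne t (mem_lowerCovers.1 ht).lt.ne)
    have e3 : (toggleFun q (toggleFun q x)).val q
        = parSumOne (upperCovers q) (toggleFun q x).val
          * sumOne (lowerCovers q) (toggleFun q x).val * ((toggleFun q x).val q)⁻¹ := by
      simp [toggleFun]
    rw [e3, e1, e2, hp]
    have h1 := (parSumOne_pos (upperCovers q) x.2).ne'
    have h2 := (sumOne_pos (lowerCovers q) x.2).ne'
    have h3 := (x.2 q).ne'
    field_simp
  · have e : (toggleFun p (toggleFun p x)).val q = (toggleFun p x).val q := by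
      conv_lhs => rw [toggleFun]
      simp [Function.update_of_ne h]
    rw [e, hne q h]

/-- The birational toggle at `p`, as a permutation of the positive labelings. -/
def toggle (p : P) : Equiv.Perm (Labeling P) :=
  (toggleFun_involutive p).toPerm

variable (P) in
/-- A linear extension of `P`: an order-preserving bijection `P → {0, …, |P| - 1}`. -/
structure LinExt where
  toEquiv : P ≃ Fin (Fintype.card P)
  monotone : Monotone toEquiv

instance : Nonempty (LinExt P) := by
  classical
  let _ : Fintype (LinearExtension P) := ‹Fintype P›
  let e := Fintype.orderIsoFinOfCardEq (LinearExtension P) (k := Fintype.card P) rfl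
  exact ⟨⟨(Equiv.refl P).trans e.symm.toEquiv,
    fun a b h => e.symm.monotone (toLinearExtension.monotone h)⟩⟩

/-- Birational rowmotion `t_{L⁻¹(1)} ∘ ⋯ ∘ t_{L⁻¹(n)}` computed with the linear extension
`L` (products in `Equiv.Perm` are compositions, so the toggles are applied from top to
bottom). -/
def rowmotion (L : LinExt P) : Equiv.Perm (Labeling P) :=
  ((List.finRange (Fintype.card P)).map (fun m => toggle (L.toEquiv.symm m))).prod

end Poset

/-! ### The rectangle, the graph `G_R` and the array `W` -/

/-- The rectangle poset `[r] × [s]` with the componentwise order. -/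
abbrev Rect (r s : ℕ) : Type := Set.Icc 1 r × Set.Icc 1 s

/-- The antipode `(r + 1 - i, s + 1 - j)` of `(i, j)`. -/
def antipode {r s : ℕ} (p : Rect r s) : Rect r s :=
  (⟨r + 1 - p.1.val, by have := p.1.2.1; have := p.1.2.2; constructor <;> omega⟩,
    ⟨s + 1 - p.2.val, by have := p.2.2.1; have := p.2.2.2; constructor <;> omega⟩)

section Graph

variable {r s : ℕ}

/-- The vertex set `[r + 1] × [s]` of `G_R`. -/
def vertices (r s : ℕ) : Finset (ℕ × ℕ) := Finset.Icc 1 (r + 1) ×ˢ Finset.Icc 1 s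

/-- The directed edges of `G_R` go from `(i, j)` to `(i + 1, j)` and to `(i + 1, j - 1)`
(whenever both ends are vertices). -/
def Step (u v : ℕ × ℕ) : Prop :=
  v = (u.1 + 1, u.2) ∨ (v.1 = u.1 + 1 ∧ v.2 + 1 = u.2)

/-- The label `x_{ij}` (used only for `(i, j) ∈ [r] × [s]`; the default is `1`). -/
def entry (x : Labeling (Rect r s)) (i j : ℕ) : ℝ :=
  open Classical in
  if h : i ∈ Set.Icc 1 r ∧ j ∈ Set.Icc 1 s then x.val (⟨i, h.1⟩, ⟨j, h.2⟩) else 1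

/-- The edge from `(i, j)` to `(i + 1, j)` has weight `x_{ij}⁻¹`, the edge from `(i, j)` to
`(i + 1, j - 1)` has weight `1`. -/
def edgeWeight (x : Labeling (Rect r s)) (u v : ℕ × ℕ) : ℝ :=
  if v.2 = u.2 then (entry x u.1 u.2)⁻¹ else 1

/-- The weight of a path (given by the list of its vertices): the product of the weights of
its edges. -/
def pathWeight (x : Labeling (Rect r s)) : List (ℕ × ℕ) → ℝ
  | u :: v :: l => edgeWeight x u v * pathWeight x (v :: l)
  | _ => 1

/-- `l` is the list of vertices of a directed path in `G_R` from `u` to `v`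
(a single vertex is a path from itself to itself). -/
structure IsPath (r s : ℕ) (u v : ℕ × ℕ) (l : List (ℕ × ℕ)) : Prop where
  mem_vertices : ∀ w ∈ l, w ∈ vertices r s
  isChain : l.IsChain Step
  head : l.head? = some u
  last : l.getLast? = some v

/-- The boundary points `P_j = (1, j)` for `1 ≤ j ≤ s` and `P_{s+i} = (i + 1, s)` for
`1 ≤ i ≤ r`. For all other indices the value is not a vertex of `G_R`. -/
def startPt (s m : ℕ) : ℕ × ℕ := if m ≤ s then (1, m) else (m - s + 1, s)

/-- The boundary points `Q_i = (i, 1)` for `1 ≤ i ≤ r` and `Q_{r+j} = (r + 1, j)` for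
`1 ≤ j ≤ s`. For all other indices the value is not a vertex of `G_R`. -/
def endPt (r m : ℕ) : ℕ × ℕ := if m ≤ r then (m, 1) else (r + 1, m - r)

/-- The set `S_{ij}^{(k)}` of all collections of `k` pairwise vertex-disjoint paths in `G_R`
starting from `{P_i, …, P_{i+k-1}}` and ending at `{Q_j, …, Q_{j+k-1}}`. A collection is
recorded as the function sending `a < k` to its path that starts from `P_{i+a}`; the
end points are allowed to be matched with the starting points by any permutation. -/
def pathFamilies (r s k i j : ℕ) : Set (Fin k → List (ℕ × ℕ)) :=
  {f | (∃ σ : Equiv.Perm (Fin k), ∀ a : Fin k,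
        IsPath r s (startPt s (i + a)) (endPt r (j + σ a)) (f a)) ∧
      ∀ a b : Fin k, a ≠ b → List.Disjoint (f a) (f b)}

theorem pathFamilies_finite (r s k i j : ℕ) : (pathFamilies r s k i j).Finite := by
  classical
  have hfin : {l : List (ℕ × ℕ) | (∀ w ∈ l, w ∈ vertices r s) ∧ l.IsChain Step}.Finite := by
    refine ((List.finite_length_le (vertices r s)
      (Fintype.card (vertices r s))).image (List.map Subtype.val)).subset ?_
    rintro l ⟨h1, h2⟩
    have h3 : l.Pairwise (fun u v => u.1 < v.1) := by
      refine List.IsChain.pairwise (h2.imp ?_)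
      rintro u v (h | h)
      · rw [h]; exact Nat.lt_succ_self _
      · have := h.1; omega
    have h4 : l.Nodup := h3.imp (fun {u v} h e => by rw [e] at h; exact lt_irrefl _ h)
    refine ⟨l.attach.map (fun w => ⟨w.1, h1 w.1 w.2⟩), ?_, ?_⟩
    · have h5 : (l.attach.map (fun w => (⟨w.1, h1 w.1 w.2⟩ : vertices r s))).Nodup := by
        refine (List.nodup_attach.2 h4).map ?_
        intro a b hab
        exact Subtype.ext (congrArg (fun z : vertices r s => z.val) hab)
      exact h5.length_le_card
    · rw [List.map_map]
      exact List.attach_map_subtype_val l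
  refine (Set.Finite.pi' (fun _ : Fin k => hfin)).subset ?_
  rintro f ⟨⟨σ, hσ⟩, -⟩ a
  exact ⟨(hσ a).mem_vertices, (hσ a).isChain⟩

/-- `W_{ij}^{(k)}(x)`, the total weight of all collections in `S_{ij}^{(k)}`. -/
def W (x : Labeling (Rect r s)) (k i j : ℕ) : ℝ :=
  ∑ f ∈ (pathFamilies_finite r s k i j).toFinset, ∏ a : Fin k, pathWeight x (f a)

end Graph

end BiRow

end

open BiRow

/-!
The proof rests on two descriptions of the array `W`.

First, `W` consists of minors. A path in `G_R` is recorded by its positions (column plus row), so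
that in each row it either keeps its position or, along a vertical edge, moves up by one. Hence
the matrix of path weights is a product of `r` unipotent bidiagonal matrices (`stepMatrix`).
Expanding the rows of a minor of such a product one factor at a time, all terms with two paths at
the same position vanish, and the others are the noncolliding families (`stepMinor_eq_sum`,
`W_succ_succ`). The octahedron recurrence is then the Desnanot–Jacobi identity
(`det_mul_det_interior`).

Second, some of these minors are explicit. A minor vanishes when its paths would need more moves
than there are rows, or when more than `s` of them have to move (`rectMinor_shift_succ_rows`,
`rectMinor_size_succ_columns`), and there is only one family of paths when these start from the
first positions or end at the last ones (`rectMinor_first`, `rectMinor_last`).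

Rowmotion `z = ρ(y)` is characterized by `z_p * y_p * ∑_{q covers p} 1 / z_q = ∑_{p covers q} y_q`
(`rowmotion_eq_of_forall`). The ratios of minors, extended to `0 ≤ k < r + s` by reciprocity at
the antipode and then periodically, form a sequence of labelings (`orbit`). Away from the places
where the two formulas meet, consecutive members satisfy the characterization by two applications
of the octahedron recurrence (`minorRatio_mul_upperSum`); where they meet, both sides are computed
by `minorRatio_zero` and `minorRatio_last`, which follow from the explicit minors
(`orbitLabel_mul_upperSum`, `orbitLabel_mul_upperSum_last`). By `minorRatio_zero` the sequence
also starts at `φ⁻¹(x)`. So it is the orbit of `φ⁻¹(x)` under `ρ⁻¹`, from which the formula for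
the iterates, the reciprocity and the periodicity can be read off. The order is not smaller than
`r + s`, since the labels at the minimum are the parallel sums of `x` over the antidiagonals, and
these can be made different from the first one.
-/

namespace BiRow

/-! ### The Desnanot–Jacobi identity -/

section Determinants

variable {R : Type*} [CommRing R]

/-- The equivalence that splits `Fin (k + 2)` into its interior and its two end points. -/
noncomputable def interiorEquiv (k : ℕ) : Fin k ⊕ Fin 2 ≃ Fin (k + 2) :=
  Equiv.ofBijective (Sum.elim (fun a => a.succ.castSucc) ![0, Fin.last _]) <| by
    rw [Fintype.bijective_iff_injective_and_card]
    refine ⟨?_, by simp⟩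
    rintro (a | a) (b | b) h
    · simpa using h
    · fin_cases b <;> simp [Fin.ext_iff] at h; omega
    · fin_cases a <;> simp [Fin.ext_iff] at h; omega
    · fin_cases a <;> fin_cases b <;> simp [Fin.ext_iff] at h ⊢

/-- A matrix whose interior columns are unit vectors has the determinant of the `2 × 2`
matrix formed by its corners. -/
theorem det_of_interior_columns_one {k : ℕ} (B : Matrix (Fin (k + 2)) (Fin (k + 2)) R)
    (hB : ∀ i, ∀ a : Fin k, B i a.succ.castSucc = if i = a.succ.castSucc then 1 else 0) :
    B.det = B 0 0 * B (Fin.last _) (Fin.last _) - B 0 (Fin.last _) * B (Fin.last _) 0 := by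
  rw [← Matrix.det_submatrix_equiv_self (interiorEquiv k) B]
  have h : B.submatrix (interiorEquiv k) (interiorEquiv k) = Matrix.fromBlocks 1
      (Matrix.of fun a b => B (interiorEquiv k (.inl a)) (interiorEquiv k (.inr b))) 0
      (Matrix.of fun a b => B (interiorEquiv k (.inr a)) (interiorEquiv k (.inr b))) := by
    ext (a | a) (b | b)
    · have : interiorEquiv k (.inl b) = b.succ.castSucc := rfl
      rw [Matrix.submatrix_apply, this, hB, ← this]
      simp [Matrix.one_apply]
    · rfl
    · have : interiorEquiv k (.inl b) = b.succ.castSucc := rfl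
      rw [Matrix.submatrix_apply, this, hB, ← this]
      simp
    · rfl
  rw [h, Matrix.det_fromBlocks_zero₂₁, Matrix.det_one, one_mul, Matrix.det_fin_two]
  rfl

/-- Expansion of a determinant whose first and last columns are multiples of the first and last
unit vectors. -/
theorem det_of_outer_columns {k : ℕ} (N : Matrix (Fin (k + 2)) (Fin (k + 2)) R)
    (d : R) (h0 : ∀ i, N i 0 = if i = 0 then d else 0)
    (h1 : ∀ i, N i (Fin.last _) = if i = Fin.last _ then d else 0) :
    N.det = d * d *
      (N.submatrix (fun a : Fin k => a.succ.castSucc) (fun a => a.succ.castSucc)).det := by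
  rw [Matrix.det_succ_column_zero, Finset.sum_eq_single 0]
  · rw [Matrix.det_succ_column _ (Fin.last _), Finset.sum_eq_single (Fin.last _)]
    · have e : (-1 : R) ^ (((Fin.last k : Fin (k + 1)) : ℕ) + ((Fin.last k : Fin (k + 1)) : ℕ))
          = 1 := by rw [← two_mul, pow_mul]; simp
      rw [e, h0]
      have h2 : N.submatrix (Fin.succAbove 0) Fin.succ (Fin.last k) (Fin.last k) = d := by
        simp [Fin.succ_last, h1]
      rw [h2, Matrix.submatrix_submatrix]
      have h3 : (Fin.succ ∘ (Fin.last k).succAbove : Fin k → Fin (k + 2))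
          = fun a => a.succ.castSucc := by
        funext a; simp
      simp only [Fin.succAbove_zero, h3]
      simp [mul_assoc]
    · intro b _ hb
      have : N.submatrix (Fin.succAbove 0) Fin.succ b (Fin.last k) = 0 := by
        have h4 : b.succ ≠ Fin.last (k + 1) := by
          rw [← Fin.succ_last]; exact fun h => hb (Fin.succ_injective _ h)
        simp [Fin.succ_last, h1, h4]
      rw [this]; ring
    · simp
  · intro b _ hb
    rw [h0, if_neg hb]; ring
  · simp

/-- The **Desnanot–Jacobi identity**. -/
theorem det_mul_det_interior {k : ℕ} (M : Matrix (Fin (k + 2)) (Fin (k + 2)) R) :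
    M.det * (M.submatrix (fun a : Fin k => a.succ.castSucc) (fun a => a.succ.castSucc)).det =
      (M.submatrix Fin.castSucc Fin.castSucc).det * (M.submatrix Fin.succ Fin.succ).det -
      (M.submatrix Fin.castSucc Fin.succ).det * (M.submatrix Fin.succ Fin.castSucc).det := by
  -- It suffices to treat the generic matrix, whose determinant can be cancelled.
  suffices H : ∀ {S : Type} [CommRing S] [IsDomain S]
      (X : Matrix (Fin (k + 2)) (Fin (k + 2)) S), X.det ≠ 0 →
      X.det * (X.submatrix (fun a : Fin k => a.succ.castSucc) (fun a => a.succ.castSucc)).det =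
      (X.submatrix Fin.castSucc Fin.castSucc).det * (X.submatrix Fin.succ Fin.succ).det -
      (X.submatrix Fin.castSucc Fin.succ).det * (X.submatrix Fin.succ Fin.castSucc).det by
    have h := H (Matrix.mvPolynomialX (Fin (k + 2)) (Fin (k + 2)) ℤ)
      (Matrix.det_mvPolynomialX_ne_zero _ _)
    have h' := congrArg (MvPolynomial.aeval (fun p : Fin (k + 2) × Fin (k + 2) => M p.1 p.2)) h
    have hM : (Matrix.mvPolynomialX (Fin (k + 2)) (Fin (k + 2)) ℤ).map
        (MvPolynomial.aeval (fun p : Fin (k + 2) × Fin (k + 2) => M p.1 p.2)) = M := by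
      ext i j; simp
    simpa only [map_mul, map_sub, AlgHom.map_det, AlgHom.mapMatrix_apply, ← Matrix.submatrix_map,
      hM] using h'
  intro S _ _ X hX
  -- `B` is the identity matrix with its outer columns replaced by those of the adjugate.
  let B : Matrix (Fin (k + 2)) (Fin (k + 2)) S := fun i j =>
    if j = 0 ∨ j = Fin.last _ then X.adjugate i j else if i = j then 1 else 0
  have hl : (0 : Fin (k + 2)) ≠ Fin.last _ := by simp [Fin.ext_iff]
  have hin : ∀ a : Fin k, ¬ (a.succ.castSucc = 0 ∨ a.succ.castSucc = Fin.last (k + 1)) := by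
    intro a; simp [Fin.ext_iff]; omega
  have hB := det_of_interior_columns_one B (fun i a => by simp only [B, if_neg (hin a)])
  have hadj : ∀ i j, (X * X.adjugate) i j = if i = j then X.det else 0 := fun i j => by
    rw [Matrix.mul_adjugate, Matrix.smul_apply, Matrix.one_apply]; simp
  have hXB := det_of_outer_columns (X * B) X.det
    (fun i => by
      rw [← hadj, Matrix.mul_apply, Matrix.mul_apply]
      exact Finset.sum_congr rfl fun m _ => by simp [B])
    (fun i => by
      rw [← hadj, Matrix.mul_apply, Matrix.mul_apply]
      exact Finset.sum_congr rfl fun m _ => by simp [B])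
  have hint : (X * B).submatrix (fun a : Fin k => a.succ.castSucc)
        (fun a : Fin k => a.succ.castSucc)
      = X.submatrix (fun a : Fin k => a.succ.castSucc) (fun a : Fin k => a.succ.castSucc) := by
    ext a b
    rw [Matrix.submatrix_apply, Matrix.mul_apply]
    simp only [B, if_neg (hin b)]
    simp
  rw [hint, Matrix.det_mul, hB, mul_assoc] at hXB
  have h1 := mul_left_cancel₀ hX hXB
  rw [← h1]
  simp only [B, true_or, or_true, if_true]
  rw [Matrix.adjugate_fin_succ_eq_det_submatrix, Matrix.adjugate_fin_succ_eq_det_submatrix,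
    Matrix.adjugate_fin_succ_eq_det_submatrix, Matrix.adjugate_fin_succ_eq_det_submatrix]
  have e1 : (-1 : S) ^ (k + 1) * (-1 : S) ^ (k + 1) = 1 := by
    rw [← pow_add, ← two_mul, pow_mul]; simp
  have e2 : (Fin.succAbove (Fin.last (k + 1))) = Fin.castSucc := by funext a; simp
  have e3 : Fin.succAbove (0 : Fin (k + 2)) = Fin.succ := by funext a; simp
  rw [e2, e3]
  simp only [Fin.val_zero, Fin.val_last, add_zero, zero_add, pow_zero, one_mul, pow_add]
  linear_combination ((X.submatrix Fin.castSucc Fin.castSucc).det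
    * (X.submatrix Fin.succ Fin.succ).det - (X.submatrix Fin.castSucc Fin.succ).det
    * (X.submatrix Fin.succ Fin.castSucc).det) * e1

/-- The solid minor of size `k` of an array with first row `i` and first column `j`. -/
def solidMinor (M : ℕ → ℕ → R) (k i j : ℕ) : R :=
  Matrix.det (Matrix.of fun a b : Fin k => M (i + a) (j + b))

/-- Solid minors satisfy the octahedron recurrence. -/
theorem solidMinor_octahedron (M : ℕ → ℕ → R) (k i j : ℕ) :
    solidMinor M (k + 1) i j * solidMinor M (k + 1) (i + 1) (j + 1)
      = solidMinor M (k + 1) i (j + 1) * solidMinor M (k + 1) (i + 1) j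
        + solidMinor M (k + 2) i j * solidMinor M k (i + 1) (j + 1) := by
  have h := det_mul_det_interior (Matrix.of fun a b : Fin (k + 2) => M (i + a) (j + b))
  simp only [Matrix.submatrix, Matrix.of_apply, Fin.val_succ, Fin.val_castSucc] at h
  have e : ∀ i' a : ℕ, i' + 1 + a = i' + (a + 1) := fun _ _ => by omega
  simp only [solidMinor, e]
  linear_combination -h

end Determinants

/-! ### Minors of products of bidiagonal matrices -/

/-- The generating function of paths that start at position `m` at time `t` and are at position `n`
after `d` steps. At each time `u` a path at position `p` either stays (with weight `1`) or moves
to `p + 1` (with weight `a u p`). This is an entry of a product of `d` bidiagonal matrices. -/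
def stepMatrix (a : ℕ → ℕ → ℝ) : (d t m n : ℕ) → ℝ
  | 0, _, m, n => if m = n then 1 else 0
  | d + 1, t, m, n => stepMatrix a d (t + 1) m n + a t m * stepMatrix a d (t + 1) (m + 1) n

/-- The minor of `stepMatrix a d t` with rows `I` and columns `J`. -/
def stepMinor (a : ℕ → ℕ → ℝ) (d t : ℕ) {k : ℕ} (I J : Fin k → ℕ) : ℝ :=
  Matrix.det (Matrix.of fun b c : Fin k => stepMatrix a d t (I b) (J c))

/-- The positions after the paths in `S` have moved. -/
def moved {k : ℕ} (I : Fin k → ℕ) (S : Finset (Fin k)) (c : Fin k) : ℕ :=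
  I c + if c ∈ S then 1 else 0

/-- `E u` is the set of paths that move at time `u`; `positions I E t` gives the positions at time
`t` of the paths with starting positions `I`. -/
def positions {k d : ℕ} (I : Fin k → ℕ) (E : Fin d → Finset (Fin k)) (t : ℕ) (c : Fin k) : ℕ :=
  I c + ∑ u : Fin d, if u.val < t ∧ c ∈ E u then 1 else 0

section StepMatrix

variable {a : ℕ → ℕ → ℝ} {k d t : ℕ}

theorem stepMatrix_of_lt {m n : ℕ} (h : n < m) : stepMatrix a d t m n = 0 := by
  induction d generalizing t m with
  | zero => simp [stepMatrix, h.ne']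
  | succ d ih => simp [stepMatrix, ih h, ih (h.trans (Nat.lt_succ_self m))]

theorem stepMatrix_self (m : ℕ) : stepMatrix a d t m m = 1 := by
  induction d generalizing t with
  | zero => simp [stepMatrix]
  | succ d ih => simp [stepMatrix, ih, stepMatrix_of_lt]

theorem stepMatrix_of_add_lt {m n : ℕ} (h : m + d < n) : stepMatrix a d t m n = 0 := by
  induction d generalizing t m with
  | zero => simp [stepMatrix, show m ≠ n by omega]
  | succ d ih => simp [stepMatrix, ih (show m + d < n by omega), ih (show m + 1 + d < n by omega)]

/-- A path that cannot leave position `m` any more stays there. -/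
theorem stepMatrix_of_forall_eq_zero {m n : ℕ} (h : ∀ u, t ≤ u → a u m = 0) (hmn : m ≠ n) :
    stepMatrix a d t m n = 0 := by
  induction d generalizing t with
  | zero => simp [stepMatrix, hmn]
  | succ d ih => rw [stepMatrix, ih fun u hu => h u (by omega), h t le_rfl, zero_mul, add_zero]

theorem stepMinor_eq_zero_of_not_injective {I J : Fin k → ℕ} (h : ¬ Function.Injective I) :
    stepMinor a d t I J = 0 := by
  simp only [Function.Injective, not_forall] at h
  obtain ⟨b, c, hbc, hne⟩ := h
  exact Matrix.det_zero_of_row_eq hne (by funext j; simp [hbc])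

theorem stepMinor_eq_zero_of_row {I J : Fin k → ℕ} (b : Fin k)
    (h : ∀ c, stepMatrix a d t (I b) (J c) = 0) : stepMinor a d t I J = 0 :=
  Matrix.det_eq_zero_of_row_eq_zero b h

/-- A minor is expanded over the set `S` of paths that move in the first step. -/
theorem stepMinor_succ (I J : Fin k → ℕ) :
    stepMinor a (d + 1) t I J
      = ∑ S : Finset (Fin k), (∏ c ∈ S, a t (I c)) * stepMinor a d (t + 1) (moved I S) J := by
  classical
  let v : Fin k → Fin k → ℝ := fun b c => stepMatrix a d (t + 1) (I b + 1) (J c)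
  let w : Fin k → Fin k → ℝ := fun b c => stepMatrix a d (t + 1) (I b) (J c)
  have h := (Matrix.detRowAlternating (R := ℝ) (n := Fin k)).toMultilinearMap.map_add_univ
    (fun b => a t (I b) • v b) w
  have h0 : ((fun b => a t (I b) • v b) + w)
      = Matrix.of fun b c : Fin k => stepMatrix a (d + 1) t (I b) (J c) := by
    funext b c
    simp [v, w, stepMatrix, add_comm]
  rw [h0] at h
  refine h.trans (Finset.sum_congr rfl fun S _ => ?_)
  have h1 : S.piecewise (fun b => a t (I b) • v b) w
      = S.piecewise (fun b => a t (I b) • (S.piecewise v w) b) (S.piecewise v w) := by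
    funext b
    by_cases hb : b ∈ S <;> simp [hb]
  rw [h1, MultilinearMap.map_piecewise_smul, smul_eq_mul]
  congr 1
  have h2 : S.piecewise v w
      = Matrix.of fun b c : Fin k => stepMatrix a d (t + 1) (moved I S b) (J c) := by
    funext b c
    by_cases hb : b ∈ S <;> simp [hb, v, w, moved]
  rw [h2]
  rfl

theorem stepMinor_zero {I J : Fin k → ℕ} (hI : StrictMono I) (hJ : StrictMono J) :
    stepMinor a 0 t I J = if I = J then 1 else 0 := by
  classical
  split_ifs with h
  · subst h
    have : (Matrix.of fun b c : Fin k => stepMatrix a 0 t (I b) (I c)) = 1 := by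
      ext b c
      simp [stepMatrix, Matrix.one_apply, hI.injective.eq_iff]
    rw [stepMinor, this, Matrix.det_one]
  · have hr : ∃ b, ∀ c, I b ≠ J c := by
      by_contra! hcon
      have hsub : Finset.univ.image I ⊆ Finset.univ.image J := by
        intro x hx
        obtain ⟨b, -, rfl⟩ := Finset.mem_image.1 hx
        obtain ⟨c, hc⟩ := hcon b
        exact Finset.mem_image.2 ⟨c, Finset.mem_univ _, hc.symm⟩
      have heq := Finset.eq_of_subset_of_card_le hsub (by
        rw [Finset.card_image_of_injective _ hI.injective,
          Finset.card_image_of_injective _ hJ.injective])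
      refine h ((hI.range_inj hJ).1 ?_)
      have := congrArg (fun s : Finset ℕ => (s : Set ℕ)) heq
      simpa using this
    obtain ⟨b, hb⟩ := hr
    exact stepMinor_eq_zero_of_row b fun c => by simp [stepMatrix, hb c]

/-- Moving some of the paths by one step keeps strictly increasing positions strictly increasing,
unless two paths collide. -/
theorem strictMono_moved_of_injective {I : Fin k → ℕ} {S : Finset (Fin k)} (hI : StrictMono I)
    (h : Function.Injective (moved I S)) : StrictMono (moved I S) := by
  intro b c hbc
  refine lt_of_le_of_ne ?_ (fun e => hbc.ne (h e))
  have := hI hbc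
  simp only [moved]
  split_ifs <;> omega

theorem positions_zero (I : Fin k → ℕ) (E : Fin d → Finset (Fin k)) : positions I E 0 = I := by
  funext c; simp [positions]

theorem positions_cons (I : Fin k → ℕ) (S : Finset (Fin k)) (E : Fin d → Finset (Fin k)) (u : ℕ) :
    positions I (Fin.cons S E : Fin (d + 1) → Finset (Fin k)) (u + 1)
      = positions (moved I S) E u := by
  funext c
  simp only [positions, moved, Fin.sum_univ_succ, Fin.cons_zero, Fin.cons_succ, Fin.val_zero,
    Fin.val_succ, Nat.zero_lt_succ, true_and, Nat.add_lt_add_iff_right, add_assoc]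

open Classical in
/-- **Lindström's lemma** for products of bidiagonal matrices: a minor is the sum over all families
of noncolliding paths. Expanding the rows of the determinant one time step at a time, every term
with a collision has two equal rows. -/
theorem stepMinor_eq_sum {I J : Fin k → ℕ} (hI : StrictMono I) (hJ : StrictMono J) :
    stepMinor a d t I J = ∑ E : Fin d → Finset (Fin k),
      if (∀ u ≤ d, StrictMono (positions I E u)) ∧ positions I E d = J then
        ∏ u : Fin d, ∏ c ∈ E u, a (t + u) (positions I E u c) else 0 := by
  induction d generalizing t I with
  | zero =>
    rw [stepMinor_zero hI hJ]
    simp [positions_zero, hI]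
  | succ d ih =>
    rw [stepMinor_succ, ← (Fin.consEquiv fun _ : Fin (d + 1) => Finset (Fin k)).sum_comp,
      Fintype.sum_prod_type]
    refine Finset.sum_congr rfl fun S _ => ?_
    have hcons : ∀ E : Fin d → Finset (Fin k),
        (Fin.consEquiv fun _ : Fin (d + 1) => Finset (Fin k)) (S, E) = Fin.cons S E := fun _ => rfl
    by_cases hS : Function.Injective (moved I S)
    · rw [ih (strictMono_moved_of_injective hI hS), Finset.mul_sum]
      refine Finset.sum_congr rfl fun E _ => ?_
      rw [hcons]
      have hiff : ((∀ u ≤ d + 1, StrictMono (positions I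
            (Fin.cons S E : Fin (d + 1) → Finset (Fin k)) u)) ∧
            positions I (Fin.cons S E : Fin (d + 1) → Finset (Fin k)) (d + 1) = J) ↔
          ((∀ u ≤ d, StrictMono (positions (moved I S) E u)) ∧
            positions (moved I S) E d = J) := by
        rw [positions_cons]
        refine and_congr_left fun _ => ⟨fun h u hu => ?_, fun h u hu => ?_⟩
        · rw [← positions_cons]; exact h _ (by omega)
        · cases u with
          | zero => rw [positions_zero]; exact hI
          | succ u => rw [positions_cons]; exact h u (by omega)
      simp only [hiff]
      rw [mul_ite, mul_zero]
      refine if_congr Iff.rfl ?_ rfl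
      rw [Fin.prod_univ_succ]
      simp [positions_zero, positions_cons, add_assoc, add_comm 1]
    · rw [stepMinor_eq_zero_of_not_injective hS, mul_zero]
      refine (Finset.sum_eq_zero fun E _ => if_neg fun h => hS ?_).symm
      have := h.1 (0 + 1) (by omega)
      rw [hcons, positions_cons, positions_zero] at this
      exact this.injective

theorem stepMinor_nonneg {I J : Fin k → ℕ} (ha : ∀ u m, 0 ≤ a u m) (hI : StrictMono I)
    (hJ : StrictMono J) : 0 ≤ stepMinor a d t I J := by
  classical
  rw [stepMinor_eq_sum hI hJ]
  refine Finset.sum_nonneg fun E _ => ?_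
  split_ifs
  · exact Finset.prod_nonneg fun u _ => Finset.prod_nonneg fun c _ => ha _ _
  · exact le_rfl

/-- When paths at consecutive positions take a step without collisions, a moving path pushes all
later ones. -/
theorem mem_of_injective_moved {m : ℕ} {S : Finset (Fin k)}
    (h : Function.Injective (moved (fun c : Fin k => m + c) S)) {b c : Fin k} (hb : b ∈ S)
    (hbc : b ≤ c) : c ∈ S := by
  obtain ⟨c, hc⟩ := c
  induction c with
  | zero =>
    have : b = ⟨0, hc⟩ := le_antisymm hbc (Fin.mk_le_mk.2 (Nat.zero_le _))
    rwa [← this]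
  | succ c ih =>
    rcases hbc.eq_or_lt with e | hlt
    · rwa [← e]
    · have h1 := ih (by omega) (by simp only [Fin.le_def, Fin.lt_def] at hlt ⊢; omega)
      by_contra h2
      have h3 := @h ⟨c, by omega⟩ ⟨c + 1, hc⟩ (by simp [moved, h1, h2]; omega)
      simp at h3

/-- If the first of several paths at consecutive positions is forced to move, then all of them
are. -/
theorem stepMinor_succ_of_first_moves {m : ℕ} {J : Fin k → ℕ}
    (h : ∀ c, stepMatrix a d (t + 1) m (J c) = 0) :
    stepMinor a (d + 1) t (fun c : Fin k => m + c) J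
      = (∏ c : Fin k, a t (m + c)) * stepMinor a d (t + 1) (fun c : Fin k => m + 1 + c) J := by
  rw [stepMinor_succ, Finset.sum_eq_single Finset.univ]
  · congr 2
    funext c; simp [moved]; omega
  · intro S _ hS
    by_cases hinj : Function.Injective (moved (fun c : Fin k => m + c) S)
    · obtain ⟨c, hc⟩ : ∃ c, c ∉ S := by
        by_contra! hcon
        exact hS (Finset.eq_univ_iff_forall.2 hcon)
      have h0 : (⟨0, c.pos⟩ : Fin k) ∉ S := fun h0 =>
        hc (mem_of_injective_moved hinj h0 (Fin.mk_le_mk.2 (Nat.zero_le _)))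
      rw [stepMinor_eq_zero_of_row ⟨0, c.pos⟩, mul_zero]
      simpa [moved, h0] using h
    · rw [stepMinor_eq_zero_of_not_injective hinj, mul_zero]
  · simp

/-- If the last of several paths at consecutive positions cannot move, then none of them can. -/
theorem stepMinor_succ_of_last_stays {m : ℕ} {J : Fin (k + 1) → ℕ} (h : a t (m + k) = 0) :
    stepMinor a (d + 1) t (fun c : Fin (k + 1) => m + c) J
      = stepMinor a d (t + 1) (fun c : Fin (k + 1) => m + c) J := by
  rw [stepMinor_succ, Finset.sum_eq_single ∅]
  · rw [Finset.prod_empty, one_mul]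
    rfl
  · intro S _ hS
    by_cases hinj : Function.Injective (moved (fun c : Fin (k + 1) => m + c) S)
    · obtain ⟨c, hc⟩ := Finset.nonempty_iff_ne_empty.2 hS
      rw [Finset.prod_eq_zero (mem_of_injective_moved hinj hc (Fin.le_last c)) (by simpa using h),
        zero_mul]
    · rw [stepMinor_eq_zero_of_not_injective hinj, mul_zero]
  · simp

end StepMatrix

/-! ### Minors of the matrix of path weights of a rectangle -/

/-- The weights of the steps in a rectangle with `s` columns: at time `t` a path at position `m`
is in column `m - t` of row `t`, and it can only move if this column is one of `0, …, s - 1`. -/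
def rectWeight (s : ℕ) (w : ℕ → ℕ → ℝ) (t m : ℕ) : ℝ :=
  if t ≤ m ∧ m < t + s then w t (m - t) else 0

/-- The minor of size `j` of the matrix of path weights of an `r × s` rectangle, with rows
`k, …, k + j - 1` and columns `k + i, …, k + i + j - 1` (counted from `0`). -/
def rectMinor (r s : ℕ) (w : ℕ → ℕ → ℝ) (j k i : ℕ) : ℝ :=
  solidMinor (stepMatrix (rectWeight s w) r 0) j k (k + i)

section RectMinor

variable {r s : ℕ} {w : ℕ → ℕ → ℝ}

theorem rectWeight_apply {t c : ℕ} (hc : c < s) : rectWeight s w t (t + c) = w t c := by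
  simp [rectWeight, hc]

theorem rectWeight_of_lt {t m : ℕ} (h : m < t) : rectWeight s w t m = 0 := by
  simp [rectWeight, show ¬ t ≤ m by omega]

theorem rectWeight_of_le {t m : ℕ} (h : t + s ≤ m) : rectWeight s w t m = 0 := by
  simp [rectWeight, show ¬ m < t + s by omega]

theorem rectWeight_nonneg (hw : ∀ t c, 0 < w t c) (t m : ℕ) : 0 ≤ rectWeight s w t m := by
  unfold rectWeight
  split_ifs
  · exact (hw _ _).le
  · exact le_rfl

theorem strictMono_add_val (m k : ℕ) : StrictMono fun c : Fin k => m + (c : ℕ) :=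
  fun _ _ h => Nat.add_lt_add_left h m

theorem rectMinor_eq_stepMinor (j k i : ℕ) : rectMinor r s w j k i
    = stepMinor (rectWeight s w) r 0 (fun c : Fin j => k + c) (fun c : Fin j => k + i + c) := rfl

theorem rectMinor_size_zero (k i : ℕ) : rectMinor r s w 0 k i = 1 := Matrix.det_isEmpty

theorem stepMinor_diagonal (a : ℕ → ℕ → ℝ) (d t m j : ℕ) :
    stepMinor a d t (fun c : Fin j => m + c) (fun c : Fin j => m + c) = 1 := by
  rw [stepMinor, Matrix.det_of_isUpperTriangular]
  · exact Finset.prod_eq_one fun c _ => stepMatrix_self _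
  · intro b c hbc
    exact stepMatrix_of_lt (Nat.add_lt_add_left hbc m)

theorem rectMinor_shift_zero (j k : ℕ) : rectMinor r s w j k 0 = 1 :=
  stepMinor_diagonal _ _ _ _ _

theorem rectMinor_nonneg (hw : ∀ t c, 0 < w t c) (j k i : ℕ) : 0 ≤ rectMinor r s w j k i :=
  stepMinor_nonneg (rectWeight_nonneg hw) (strictMono_add_val _ _) (strictMono_add_val _ _)

/-- No path can move more often than there are rows. -/
theorem rectMinor_shift_succ_rows (j k : ℕ) : rectMinor r s w (j + 1) k (r + 1) = 0 :=
  stepMinor_eq_zero_of_row 0 fun c => stepMatrix_of_add_lt (by simp; omega)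

/-- More than `s` noncolliding paths with consecutive starting points cannot all move: as long as
the first of them is in one of the columns, the last one is to the right of all columns. -/
theorem stepMinor_size_succ_columns {d t m : ℕ} {J : Fin (s + 1) → ℕ} (hJ : ∀ c, m < J c) :
    stepMinor (rectWeight s w) d t (fun c : Fin (s + 1) => m + c) J = 0 := by
  induction d generalizing t with
  | zero => exact stepMinor_eq_zero_of_row 0 fun c => by simp [stepMatrix, (hJ c).ne]
  | succ d ih =>
    rcases lt_or_ge m t with h | h
    · refine stepMinor_eq_zero_of_row 0 fun c =>
        stepMatrix_of_forall_eq_zero (fun u hu => rectWeight_of_lt ?_) ?_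
      · simp; omega
      · simpa using (hJ c).ne
    · rw [stepMinor_succ_of_last_stays (rectWeight_of_le (by omega)), ih]

theorem rectMinor_size_succ_columns (k i : ℕ) : rectMinor r s w (s + 1) k (i + 1) = 0 :=
  stepMinor_size_succ_columns fun c => by omega

theorem stepMinor_first_rows {d t i j : ℕ} (hi : i ≤ d) (hj : j ≤ s) :
    stepMinor (rectWeight s w) d t (fun c : Fin j => t + c) (fun c : Fin j => t + i + c)
      = ∏ u ∈ range i, ∏ c ∈ range j, w (t + u) c := by
  induction i generalizing d t with
  | zero => simpa using stepMinor_diagonal _ _ _ _ _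
  | succ i ih =>
    obtain ⟨d, rfl⟩ : ∃ d', d = d' + 1 := ⟨d - 1, by omega⟩
    rw [stepMinor_succ_of_first_moves fun c => stepMatrix_of_forall_eq_zero
      (fun u hu => rectWeight_of_lt (by omega)) (by omega), Finset.prod_range_succ',
      mul_comm, Finset.prod_range (n := j) (f := fun c => w (t + 0) c)]
    have h := ih (d := d) (t := t + 1) (by omega)
    have e : (fun c : Fin j => t + (i + 1) + (c : ℕ)) = fun c : Fin j => t + 1 + i + (c : ℕ) := by
      funext c; omega
    rw [e, h]
    congr 1
    · exact Finset.prod_congr rfl fun u _ => by rw [show t + 1 + u = t + (u + 1) by omega]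
    · exact Finset.prod_congr rfl fun c _ => rectWeight_apply (by omega)

/-- The paths starting at the first `j` positions have no choice: they have to move in each of the
first `i` rows. -/
theorem rectMinor_first {i j : ℕ} (hi : i ≤ r) (hj : j ≤ s) :
    rectMinor r s w j 0 i = ∏ u ∈ range i, ∏ c ∈ range j, w u c := by
  rw [rectMinor_eq_stepMinor, stepMinor_first_rows hi hj]
  simp

theorem stepMinor_last_rows {t i j q : ℕ} (hj : j + q ≤ s) :
    stepMinor (rectWeight s w) i t (fun c : Fin j => t + q + c) (fun c : Fin j => t + q + i + c)
      = ∏ u ∈ range i, ∏ c ∈ range j, w (t + u) (q + c) := by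
  induction i generalizing t with
  | zero => simpa using stepMinor_diagonal _ _ _ _ _
  | succ i ih =>
    rw [stepMinor_succ_of_first_moves fun c => stepMatrix_of_add_lt (by omega),
      Finset.prod_range_succ', mul_comm,
      Finset.prod_range (n := j) (f := fun c => w (t + 0) (q + c))]
    have h := ih (t := t + 1)
    have e1 : (fun c : Fin j => t + q + (i + 1) + (c : ℕ))
        = fun c : Fin j => t + 1 + q + i + (c : ℕ) := by
      funext c; omega
    have e2 : (fun c : Fin j => t + q + 1 + (c : ℕ)) = fun c : Fin j => t + 1 + q + (c : ℕ) := by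
      funext c; omega
    rw [e1, e2, h]
    congr 1
    · exact Finset.prod_congr rfl fun u _ => by rw [show t + 1 + u = t + (u + 1) by omega]
    · refine Finset.prod_congr rfl fun c _ => ?_
      rw [add_assoc, rectWeight_apply (by omega), add_zero]

theorem stepMinor_skip_rows {d p t m j : ℕ} {J : Fin (j + 1) → ℕ} (h : t + p + s ≤ m + j + 1) :
    stepMinor (rectWeight s w) (d + p) t (fun c : Fin (j + 1) => m + c) J
      = stepMinor (rectWeight s w) d (t + p) (fun c : Fin (j + 1) => m + c) J := by
  induction p generalizing t with
  | zero => rfl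
  | succ p ih =>
    rw [← add_assoc, stepMinor_succ_of_last_stays (rectWeight_of_le (by omega)), ih (by omega),
      show t + (p + 1) = t + 1 + p by omega]

/-- The paths ending at the last `j` positions have no choice: the last one of them is to the right
of all columns in the first `p = r - i` rows, and then they have to move in each of the
remaining rows. -/
theorem rectMinor_last {i j p q : ℕ} (hr : i + p = r) (hs : j + q = s) :
    rectMinor r s w j (p + q) i = ∏ u ∈ range i, ∏ c ∈ range j, w (p + u) (q + c) := by
  cases j with
  | zero => simp [rectMinor_size_zero]
  | succ j =>
    rw [rectMinor_eq_stepMinor, ← hr, stepMinor_skip_rows (by omega), zero_add,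
      stepMinor_last_rows hs.le]

theorem rectMinor_octahedron (j k i : ℕ) :
    rectMinor r s w (j + 1) k (i + 1) * rectMinor r s w (j + 1) (k + 1) (i + 1)
      = rectMinor r s w (j + 1) k (i + 2) * rectMinor r s w (j + 1) (k + 1) i
        + rectMinor r s w (j + 2) k (i + 1) * rectMinor r s w j (k + 1) (i + 1) := by
  have h := solidMinor_octahedron (stepMatrix (rectWeight s w) r 0) j k (k + (i + 1))
  simp only [rectMinor]
  rw [show k + 1 + (i + 1) = k + (i + 1) + 1 by omega, show k + (i + 2) = k + (i + 1) + 1 by omega,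
    show k + 1 + i = k + (i + 1) by omega]
  exact h

/-- Positivity propagates from the first rows through the octahedron recurrence. -/
theorem rectMinor_pos (hw : ∀ t c, 0 < w t c) {j k i : ℕ} (hi : i ≤ r) (hj : j ≤ s)
    (h : k + i + j ≤ r + s) : 0 < rectMinor r s w j k i := by
  induction k generalizing i j with
  | zero =>
    rw [rectMinor_first hi hj]
    exact Finset.prod_pos fun u _ => Finset.prod_pos fun c _ => hw _ _
  | succ k ihk =>
    obtain ⟨n, hn⟩ : ∃ n, i + j = n := ⟨_, rfl⟩
    induction n using Nat.strong_induction_on generalizing i j with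
    | _ n ih =>
      rcases i with _ | i
      · rw [rectMinor_shift_zero]; exact one_pos
      rcases j with _ | j
      · rw [rectMinor_size_zero]; exact one_pos
      have h0 : 0 < rectMinor r s w (j + 1) k (i + 1) := ihk hi hj (by omega)
      refine pos_of_mul_pos_right (a := rectMinor r s w (j + 1) k (i + 1)) ?_ h0.le
      rw [rectMinor_octahedron]
      by_cases hir : i + 2 ≤ r
      · exact add_pos_of_pos_of_nonneg
          (mul_pos (ihk hir hj (by omega)) (ih (i + (j + 1)) (by omega) (by omega) hj (by omega) rfl))
          (mul_nonneg (rectMinor_nonneg hw _ _ _) (rectMinor_nonneg hw _ _ _))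
      · exact add_pos_of_nonneg_of_pos
          (mul_nonneg (rectMinor_nonneg hw _ _ _) (rectMinor_nonneg hw _ _ _))
          (mul_pos (ihk hi (by omega) (by omega))
            (ih (i + 1 + j) (by omega) hi (by omega) (by omega) rfl))

end RectMinor

/-! ### Ratios of minors -/

/-- Sum of the values at the elements covered by `(i, j)` in a rectangle with coordinates counted
from `0`; the empty sum is `1`. -/
noncomputable def lowerSum (F : ℕ → ℕ → ℝ) (i j : ℕ) : ℝ :=
  if i = 0 ∧ j = 0 then 1
  else (if 0 < i then F (i - 1) j else 0) + if 0 < j then F i (j - 1) else 0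

/-- Sum of the inverses of the values at the elements covering `(i, j)` in an `r × s` rectangle with
coordinates counted from `0`; the empty sum is `1`. -/
noncomputable def upperSum (r s : ℕ) (F : ℕ → ℕ → ℝ) (i j : ℕ) : ℝ :=
  if i + 1 = r ∧ j + 1 = s then 1
  else (if i + 1 < r then (F (i + 1) j)⁻¹ else 0) + if j + 1 < s then (F i (j + 1))⁻¹ else 0

/-- The ratios of minors that give the iterates of inverse rowmotion, with coordinates counted
from `0`. -/
noncomputable def minorRatio (r s : ℕ) (w : ℕ → ℕ → ℝ) (k i j : ℕ) : ℝ :=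
  rectMinor r s w j (k + 1) i / rectMinor r s w (j + 1) k (i + 1)

section MinorRatio

variable {r s : ℕ} {w : ℕ → ℕ → ℝ}

theorem minorRatio_pos (hw : ∀ t c, 0 < w t c) {k i j : ℕ} (hi : i < r) (hj : j < s)
    (h : k + i + j + 2 ≤ r + s) : 0 < minorRatio r s w k i j :=
  div_pos (rectMinor_pos hw (by omega) (by omega) (by omega))
    (rectMinor_pos hw (by omega) (by omega) (by omega))

theorem lowerSum_minorRatio (hw : ∀ t c, 0 < w t c) {k i j : ℕ} (hi : i < r) (hj : j < s)
    (h : k + i + j + 1 ≤ r + s) :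
    lowerSum (minorRatio r s w k) i j = rectMinor r s w j k i * rectMinor r s w j (k + 1) i /
      (rectMinor r s w j k (i + 1) * rectMinor r s w (j + 1) k i) := by
  have p1 : 0 < rectMinor r s w j k (i + 1) := rectMinor_pos hw (by omega) (by omega) (by omega)
  have p2 : 0 < rectMinor r s w (j + 1) k i := rectMinor_pos hw (by omega) (by omega) (by omega)
  rcases i with _ | i <;> rcases j with _ | j
  · simp [lowerSum, rectMinor_shift_zero, rectMinor_size_zero]
  · simp [lowerSum, minorRatio, rectMinor_shift_zero]
  · simp [lowerSum, minorRatio, rectMinor_size_zero]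
  · have e := rectMinor_octahedron (r := r) (s := s) (w := w) j k i
    simp only [lowerSum, minorRatio, Nat.succ_ne_zero, false_and, if_false, Nat.zero_lt_succ,
      if_true, Nat.add_sub_cancel]
    rw [e]
    field_simp

theorem upperSum_minorRatio (hw : ∀ t c, 0 < w t c) {k i j : ℕ} (hi : i < r) (hj : j < s)
    (h : k + i + j + 3 ≤ r + s) :
    upperSum r s (minorRatio r s w k) i j =
      rectMinor r s w (j + 1) k (i + 1) * rectMinor r s w (j + 1) (k + 1) (i + 1) /
      (rectMinor r s w j (k + 1) (i + 1) * rectMinor r s w (j + 1) (k + 1) i) := by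
  have p1 : 0 < rectMinor r s w j (k + 1) (i + 1) :=
    rectMinor_pos hw (by omega) (by omega) (by omega)
  have p2 : 0 < rectMinor r s w (j + 1) (k + 1) i :=
    rectMinor_pos hw (by omega) (by omega) (by omega)
  have h1 : (if i + 1 < r then (minorRatio r s w k (i + 1) j)⁻¹ else 0)
      = rectMinor r s w (j + 1) k (i + 2) / rectMinor r s w j (k + 1) (i + 1) := by
    split_ifs with hc
    · rw [minorRatio, inv_div]
    · rw [show i + 2 = r + 1 by omega, rectMinor_shift_succ_rows, zero_div]
  have h2 : (if j + 1 < s then (minorRatio r s w k i (j + 1))⁻¹ else 0)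
      = rectMinor r s w (j + 2) k (i + 1) / rectMinor r s w (j + 1) (k + 1) i := by
    split_ifs with hc
    · rw [minorRatio, inv_div]
    · rw [show j + 2 = s + 1 by omega, rectMinor_size_succ_columns, zero_div]
  rw [upperSum, if_neg (by omega), h1, h2, rectMinor_octahedron]
  field_simp

/-- The relation between the labels of a labeling and those of its image under inverse rowmotion,
for ratios of minors. -/
theorem minorRatio_mul_upperSum (hw : ∀ t c, 0 < w t c) {k i j : ℕ} (hi : i < r) (hj : j < s)
    (h : k + i + j + 3 ≤ r + s) :
    minorRatio r s w k i j * minorRatio r s w (k + 1) i j * upperSum r s (minorRatio r s w k) i j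
      = lowerSum (minorRatio r s w (k + 1)) i j := by
  rw [upperSum_minorRatio hw hi hj h, lowerSum_minorRatio hw hi hj (by omega), minorRatio,
    minorRatio]
  have p1 : 0 < rectMinor r s w (j + 1) k (i + 1) :=
    rectMinor_pos hw (by omega) (by omega) (by omega)
  have p2 : 0 < rectMinor r s w (j + 1) (k + 1) (i + 1) :=
    rectMinor_pos hw (by omega) (by omega) (by omega)
  field_simp

/-- For `k = 0` the ratios of minors are the preimage of `w⁻¹` under the transfer map. -/
theorem minorRatio_zero (hw : ∀ t c, 0 < w t c) {i j : ℕ} (hi : i < r) (hj : j < s) :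
    minorRatio r s w 0 i j = (w i j)⁻¹ * lowerSum (minorRatio r s w 0) i j := by
  rw [lowerSum_minorRatio hw hi hj (by omega), minorRatio, rectMinor_first (by omega) (by omega),
    rectMinor_first (by omega) (by omega), rectMinor_first (by omega) (by omega),
    rectMinor_first (by omega) (by omega)]
  have hP : ∀ a b, (∏ u ∈ range a, ∏ c ∈ range b, w u c) ≠ 0 := fun a b =>
    (Finset.prod_pos fun u _ => Finset.prod_pos fun c _ => hw _ _).ne'
  have hQ : ∀ b, (∏ c ∈ range b, w i c) ≠ 0 := fun b =>
    (Finset.prod_pos fun c _ => hw _ _).ne'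
  have h0 := (hw i j).ne'
  rw [Finset.prod_range_succ _ i, Finset.prod_range_succ _ i, Finset.prod_range_succ _ j]
  have := hP i j
  have := hP i (j + 1)
  have := hQ j
  field_simp

/-- The analogue of `minorRatio_zero` for the largest possible `k`. -/
theorem minorRatio_last (hw : ∀ t c, 0 < w t c) {k i j : ℕ} (hi : i < r) (hj : j < s)
    (h : k + i + j + 2 = r + s) :
    minorRatio r s w k i j
      = (w (r - 1 - i) (s - 1 - j))⁻¹ * lowerSum (minorRatio r s w (k + 1)) i j := by
  obtain ⟨p, rfl⟩ : ∃ p, r = i + 1 + p := ⟨r - (i + 1), by omega⟩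
  obtain ⟨q, rfl⟩ : ∃ q, s = j + 1 + q := ⟨s - (j + 1), by omega⟩
  obtain rfl : k = p + q := by omega
  rw [lowerSum_minorRatio hw hi hj (by omega), minorRatio,
    rectMinor_last (i := i + 1) (j := j + 1) (p := p) (q := q) rfl rfl,
    show i + 1 + p - 1 - i = p by omega, show j + 1 + q - 1 - j = q by omega]
  have e1 : rectMinor (i + 1 + p) (j + 1 + q) w j (p + q + 1) (i + 1)
      = ∏ u ∈ range (i + 1), ∏ c ∈ range j, w (p + u) (q + 1 + c) :=
    rectMinor_last (q := q + 1) rfl (by omega)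
  have e2 : rectMinor (i + 1 + p) (j + 1 + q) w (j + 1) (p + q + 1) i
      = ∏ u ∈ range i, ∏ c ∈ range (j + 1), w (p + 1 + u) (q + c) := by
    rw [show p + q + 1 = p + 1 + q by omega]
    exact rectMinor_last (by omega) rfl
  have e3 : rectMinor (i + 1 + p) (j + 1 + q) w j (p + q + 1 + 1) i
      = ∏ u ∈ range i, ∏ c ∈ range j, w (p + 1 + u) (q + 1 + c) := by
    rw [show p + q + 1 + 1 = p + 1 + (q + 1) by omega]
    exact rectMinor_last (by omega) (by omega)
  rw [e1, e2, e3, Finset.prod_range_succ' _ i, Finset.prod_range_succ' _ i,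
    Finset.prod_range_succ' (fun c => w (p + 0) (q + c)) j]
  have hsh : ∀ a b : ℕ, a + 1 + b = a + (b + 1) := fun _ _ => by omega
  simp only [hsh, add_zero]
  have hP : ∀ f g : ℕ → ℕ, (∏ u ∈ range i, ∏ c ∈ range j, w (f u) (g c)) ≠ 0 := fun f g =>
    (Finset.prod_pos fun u _ => Finset.prod_pos fun c _ => hw _ _).ne'
  have hP' : ∀ f g : ℕ → ℕ, (∏ u ∈ range i, ∏ c ∈ range (j + 1), w (f u) (g c)) ≠ 0 := fun f g =>
    (Finset.prod_pos fun u _ => Finset.prod_pos fun c _ => hw _ _).ne'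
  have hQ : ∀ g : ℕ → ℕ, (∏ c ∈ range j, w p (g c)) ≠ 0 := fun g =>
    (Finset.prod_pos fun c _ => hw _ _).ne'
  have := hP (fun u => p + (u + 1)) fun c => q + (c + 1)
  have := hP' (fun u => p + (u + 1)) fun c => q + c
  have := hQ fun c => q + (c + 1)
  have := (hw p q).ne'
  have hne : rectMinor (i + 1 + p) (j + 1 + q) w j (p + q + 1) i ≠ 0 :=
    (rectMinor_pos hw (by omega) (by omega) (by omega)).ne'
  field_simp

end MinorRatio

/-! ### The orbit of inverse rowmotion as a sequence of functions -/

/-- The orbit of a labeling under inverse rowmotion, for `k < r + s`, with coordinates counted from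
`0`: ratios of minors, continued by reciprocity with respect to the antipode. -/
noncomputable def orbitLabel (r s : ℕ) (w : ℕ → ℕ → ℝ) (k i j : ℕ) : ℝ :=
  if k + i + j + 2 ≤ r + s then minorRatio r s w k i j
  else (minorRatio r s w (k + i + j + 1 - (r + s)) (r - 1 - i) (s - 1 - j))⁻¹

section OrbitLabel

variable {r s : ℕ} {w : ℕ → ℕ → ℝ}

theorem lowerSum_congr {F G : ℕ → ℕ → ℝ} {i j : ℕ} (h1 : 0 < i → F (i - 1) j = G (i - 1) j)
    (h2 : 0 < j → F i (j - 1) = G i (j - 1)) : lowerSum F i j = lowerSum G i j := by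
  unfold lowerSum
  split_ifs <;> simp_all

theorem upperSum_congr {F G : ℕ → ℕ → ℝ} {i j : ℕ} (h1 : i + 1 < r → F (i + 1) j = G (i + 1) j)
    (h2 : j + 1 < s → F i (j + 1) = G i (j + 1)) : upperSum r s F i j = upperSum r s G i j := by
  unfold upperSum
  split_ifs <;> simp_all

/-- The antipode exchanges lower and upper covers. -/
theorem upperSum_eq_lowerSum_reflect {F G : ℕ → ℕ → ℝ} {i j : ℕ} (hi : i < r) (hj : j < s)
    (h1 : i + 1 < r → F (i + 1) j = (G (r - 1 - i - 1) (s - 1 - j))⁻¹)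
    (h2 : j + 1 < s → F i (j + 1) = (G (r - 1 - i) (s - 1 - j - 1))⁻¹) :
    upperSum r s F i j = lowerSum G (r - 1 - i) (s - 1 - j) := by
  unfold upperSum lowerSum
  congr 1
  · exact propext (by omega)
  · congr 1
    · split_ifs with a b b
      · rw [h1 a, inv_inv]
      · omega
      · omega
      · rfl
    · split_ifs with a b b
      · rw [h2 a, inv_inv]
      · omega
      · omega
      · rfl

theorem lowerSum_eq_upperSum_reflect {F G : ℕ → ℕ → ℝ} {i j : ℕ} (hi : i < r) (hj : j < s)
    (h1 : 0 < i → F (i - 1) j = (G (r - 1 - i + 1) (s - 1 - j))⁻¹)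
    (h2 : 0 < j → F i (j - 1) = (G (r - 1 - i) (s - 1 - j + 1))⁻¹) :
    lowerSum F i j = upperSum r s G (r - 1 - i) (s - 1 - j) := by
  unfold upperSum lowerSum
  congr 1
  · exact propext (by omega)
  · congr 1
    · split_ifs with a b b
      · rw [h1 a]
      · omega
      · omega
      · rfl
    · split_ifs with a b b
      · rw [h2 a]
      · omega
      · omega
      · rfl

theorem orbitLabel_of_le {k i j : ℕ} (h : k + i + j + 2 ≤ r + s) :
    orbitLabel r s w k i j = minorRatio r s w k i j := if_pos h

theorem orbitLabel_eq_inv {k l i j i' j' : ℕ} (h : k + i + j + 1 = r + s + l)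
    (hi : i + i' + 1 = r) (hj : j + j' + 1 = s) :
    orbitLabel r s w k i j = (minorRatio r s w l i' j')⁻¹ := by
  rw [orbitLabel, if_neg (by omega)]
  congr 2 <;> omega

theorem orbitLabel_pos (hw : ∀ t c, 0 < w t c) {k i j : ℕ} (hi : i < r) (hj : j < s)
    (h : k < r + s) : 0 < orbitLabel r s w k i j := by
  rw [orbitLabel]
  split_ifs with hc
  · exact minorRatio_pos hw hi hj hc
  · exact inv_pos.2 (minorRatio_pos hw (by omega) (by omega) (by omega))

/-- Consecutive labelings of the orbit are related by rowmotion. Below the antidiagonal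
`k + i + j + 2 = r + s` this is the octahedron recurrence, above it is the same relation at the
antipode, and on it both sides are computed by the minors with only one family of paths. -/
theorem orbitLabel_mul_upperSum (hw : ∀ t c, 0 < w t c) {k i j : ℕ} (hi : i < r) (hj : j < s)
    (h : k + 1 < r + s) :
    orbitLabel r s w k i j * orbitLabel r s w (k + 1) i j * upperSum r s (orbitLabel r s w k) i j
      = lowerSum (orbitLabel r s w (k + 1)) i j := by
  rcases lt_trichotomy (k + i + j + 2) (r + s) with hc | hc | hc
  · rw [orbitLabel_of_le (by omega), orbitLabel_of_le (by omega),
      upperSum_congr (G := minorRatio r s w k) (fun _ => orbitLabel_of_le (by omega))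
        (fun _ => orbitLabel_of_le (by omega)),
      lowerSum_congr (G := minorRatio r s w (k + 1)) (fun _ => orbitLabel_of_le (by omega))
        (fun _ => orbitLabel_of_le (by omega))]
    exact minorRatio_mul_upperSum hw hi hj (by omega)
  · rw [orbitLabel_of_le (by omega),
      orbitLabel_eq_inv (l := 0) (i' := r - 1 - i) (j' := s - 1 - j) (by omega) (by omega)
        (by omega),
      upperSum_eq_lowerSum_reflect (G := minorRatio r s w 0) hi hj
        (fun _ => orbitLabel_eq_inv (by omega) (by omega) (by omega))
        (fun _ => orbitLabel_eq_inv (by omega) (by omega) (by omega)),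
      lowerSum_congr (G := minorRatio r s w (k + 1)) (fun _ => orbitLabel_of_le (by omega))
        (fun _ => orbitLabel_of_le (by omega)), minorRatio_last hw hi hj hc]
    have h0 := minorRatio_zero hw (i := r - 1 - i) (j := s - 1 - j) (r := r) (s := s) (by omega)
      (by omega)
    have p0 := minorRatio_pos hw (k := 0) (i := r - 1 - i) (j := s - 1 - j) (r := r) (s := s)
      (by omega) (by omega) (by omega)
    calc _ = lowerSum (minorRatio r s w (k + 1)) i j
            * ((minorRatio r s w 0 (r - 1 - i) (s - 1 - j))⁻¹ * ((w (r - 1 - i) (s - 1 - j))⁻¹ *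
              lowerSum (minorRatio r s w 0) (r - 1 - i) (s - 1 - j))) := by ring
      _ = _ := by rw [← h0, inv_mul_cancel₀ p0.ne', mul_one]
  · obtain ⟨l, hl⟩ : ∃ l, k + i + j + 1 = r + s + l := ⟨k + i + j + 1 - (r + s), by omega⟩
    rw [orbitLabel_eq_inv (l := l) (i' := r - 1 - i) (j' := s - 1 - j) (by omega) (by omega)
        (by omega),
      orbitLabel_eq_inv (l := l + 1) (i' := r - 1 - i) (j' := s - 1 - j) (by omega) (by omega)
        (by omega),
      upperSum_eq_lowerSum_reflect (G := minorRatio r s w (l + 1)) hi hj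
        (fun _ => orbitLabel_eq_inv (by omega) (by omega) (by omega))
        (fun _ => orbitLabel_eq_inv (by omega) (by omega) (by omega)),
      lowerSum_eq_upperSum_reflect (G := minorRatio r s w l) hi hj
        (fun _ => orbitLabel_eq_inv (by omega) (by omega) (by omega))
        (fun _ => orbitLabel_eq_inv (by omega) (by omega) (by omega)),
      ← minorRatio_mul_upperSum hw (by omega) (by omega) (by omega)]
    have p0 := minorRatio_pos hw (k := l) (i := r - 1 - i) (j := s - 1 - j) (r := r) (s := s)
      (by omega) (by omega) (by omega)
    have p1 := minorRatio_pos hw (k := l + 1) (i := r - 1 - i) (j := s - 1 - j) (r := r) (s := s)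
      (by omega) (by omega) (by omega)
    field_simp

/-- The orbit closes up after `r + s` steps. -/
theorem orbitLabel_mul_upperSum_last (hw : ∀ t c, 0 < w t c) {k i j : ℕ} (hi : i < r) (hj : j < s)
    (h : k + 1 = r + s) :
    orbitLabel r s w k i j * orbitLabel r s w 0 i j * upperSum r s (orbitLabel r s w k) i j
      = lowerSum (orbitLabel r s w 0) i j := by
  rw [orbitLabel_of_le (k := 0) (by omega),
    orbitLabel_eq_inv (l := i + j) (i' := r - 1 - i) (j' := s - 1 - j) (by omega) (by omega)
      (by omega),
    upperSum_eq_lowerSum_reflect (G := minorRatio r s w (i + j + 1)) hi hj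
      (fun _ => orbitLabel_eq_inv (by omega) (by omega) (by omega))
      (fun _ => orbitLabel_eq_inv (by omega) (by omega) (by omega)),
    lowerSum_congr (F := orbitLabel r s w 0) (G := minorRatio r s w 0)
      (fun _ => orbitLabel_of_le (by omega)) (fun _ => orbitLabel_of_le (by omega)),
    minorRatio_zero hw hi hj]
  have h0 := minorRatio_last hw (k := i + j) (i := r - 1 - i) (j := s - 1 - j) (r := r) (s := s)
    (by omega) (by omega) (by omega)
  have p0 := minorRatio_pos hw (k := i + j) (i := r - 1 - i) (j := s - 1 - j) (r := r) (s := s)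
    (by omega) (by omega) (by omega)
  rw [show r - 1 - (r - 1 - i) = i by omega, show s - 1 - (s - 1 - j) = j by omega] at h0
  calc _ = lowerSum (minorRatio r s w 0) i j
          * ((minorRatio r s w (i + j) (r - 1 - i) (s - 1 - j))⁻¹ * ((w i j)⁻¹ *
            lowerSum (minorRatio r s w (i + j + 1)) (r - 1 - i) (s - 1 - j))) := by ring
    _ = _ := by rw [← h0, inv_mul_cancel₀ p0.ne', mul_one]

end OrbitLabel

/-! ### Rowmotion in terms of covers -/

section Rowmotion

variable {P : Type*} [PartialOrder P] [Fintype P]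

theorem toggle_apply_of_ne {p q : P} (h : q ≠ p) (x : Labeling P) :
    (toggle p x).val q = x.val q := by
  classical
  change (toggleFun p x).val q = _
  simp [toggleFun, Function.update_of_ne h]

theorem toggle_apply_self (p : P) (x : Labeling P) : (toggle p x).val p =
    parSumOne (upperCovers p) x.val * sumOne (lowerCovers p) x.val * (x.val p)⁻¹ := by
  change (toggleFun p x).val p = _
  simp [toggleFun]

theorem prod_toggle_apply_of_notMem {l : List P} {q : P} (h : q ∉ l) (y : Labeling P) :
    ((l.map toggle).prod y).val q = y.val q := by
  induction l with
  | nil => rfl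
  | cons p l ih =>
    rw [List.mem_cons, not_or] at h
    rw [List.map_cons, List.prod_cons, Equiv.Perm.mul_apply, toggle_apply_of_ne h.1, ih h.2]

/-- When the elements of `l` are toggled from the last one to the first one, and smaller elements
come first, the toggle at `p` sees the new labels above `p` and the old labels below `p`. -/
theorem prod_toggle_apply {l : List P} (hl : l.Pairwise fun p q => ¬ q ≤ p) (y : Labeling P) {p : P}
    (hp : p ∈ l) : ((l.map toggle).prod y).val p =
      parSumOne (upperCovers p) ((l.map toggle).prod y).val * sumOne (lowerCovers p) y.val
        * (y.val p)⁻¹ := by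
  induction l with
  | nil => simp at hp
  | cons a l ih =>
    rw [List.pairwise_cons] at hl
    rw [List.map_cons, List.prod_cons, Equiv.Perm.mul_apply]
    by_cases hpa : p = a
    · subst hpa
      have hpl : p ∉ l := fun h => hl.1 p h le_rfl
      rw [toggle_apply_self, prod_toggle_apply_of_notMem hpl]
      congr 2
      · exact parSumOne_congr fun q hq =>
          (toggle_apply_of_ne (mem_upperCovers.1 hq).lt.ne' _).symm
      · exact sumOne_congr fun q hq => prod_toggle_apply_of_notMem
          (fun h => hl.1 q h (mem_lowerCovers.1 hq).le) y
    · have hpl : p ∈ l := (List.mem_cons.1 hp).resolve_left hpa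
      rw [toggle_apply_of_ne hpa, ih hl.2 hpl]
      congr 2
      refine parSumOne_congr fun q hq => (toggle_apply_of_ne ?_ _).symm
      rintro rfl
      exact hl.1 p hpl (mem_upperCovers.1 hq).le

theorem rowmotion_apply (L : LinExt P) (y : Labeling P) (p : P) : (rowmotion L y).val p =
    parSumOne (upperCovers p) (rowmotion L y).val * sumOne (lowerCovers p) y.val
      * (y.val p)⁻¹ := by
  have e : (List.finRange (Fintype.card P)).map (fun m => toggle (L.toEquiv.symm m))
      = ((List.finRange (Fintype.card P)).map L.toEquiv.symm).map toggle := by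
    rw [List.map_map]; rfl
  rw [rowmotion, e]
  refine prod_toggle_apply ?_ y (List.mem_map.2 ⟨L.toEquiv p, List.mem_finRange _, by simp⟩)
  refine List.Pairwise.map _ (fun a b hab => ?_) (List.pairwise_lt_finRange _)
  intro hle
  have := L.monotone hle
  simp only [Equiv.apply_symm_apply] at this
  exact absurd hab (not_lt.2 this)

/-- Rowmotion is determined by the relation between the old and the new labels. -/
theorem rowmotion_eq_of_forall (L : LinExt P) {y z : Labeling P}
    (h : ∀ p, z.val p = parSumOne (upperCovers p) z.val * sumOne (lowerCovers p) y.val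
      * (y.val p)⁻¹) : rowmotion L y = z := by
  have hwf : WellFounded ((· > ·) : P → P → Prop) := wellFounded_gt
  apply Subtype.ext
  funext p
  induction p using hwf.induction with
  | _ p ih =>
    rw [rowmotion_apply, h p, parSumOne_congr fun q hq => ih q (mem_upperCovers.1 hq).lt]

end Rowmotion

section Rect

theorem sum_of_two_points {P : Type*} {S : Finset P} {A B : Prop} [Decidable A] [Decidable B]
    (a : A → P) (b : B → P) (hS : ∀ q, q ∈ S ↔ (∃ h, q = a h) ∨ ∃ h, q = b h)
    (hab : ∀ h h', a h ≠ b h') (f : P → ℝ) :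
    ∑ q ∈ S, f q = (if h : A then f (a h) else 0) + if h : B then f (b h) else 0 := by
  classical
  by_cases hA : A <;> by_cases hB : B
  · obtain rfl : S = {a hA, b hB} := by ext q; simp [hS, hA, hB]
    rw [Finset.sum_pair (hab hA hB), dif_pos hA, dif_pos hB]
  · obtain rfl : S = {a hA} := by ext q; simp [hS, hA, hB]
    simp [hA, hB]
  · obtain rfl : S = {b hB} := by ext q; simp [hS, hA, hB]
    simp [hA, hB]
  · obtain rfl : S = ∅ := by ext q; simp [hS, hA, hB]
    simp [hA, hB]

theorem eq_empty_of_two_points {P : Type*} {S : Finset P} {A B : Prop}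
    (a : A → P) (b : B → P) (hS : ∀ q, q ∈ S ↔ (∃ h, q = a h) ∨ ∃ h, q = b h) :
    S = ∅ ↔ ¬ A ∧ ¬ B := by
  constructor
  · rintro rfl
    exact ⟨fun h => by simpa using (hS (a h)).2 (Or.inl ⟨h, rfl⟩),
      fun h => by simpa using (hS (b h)).2 (Or.inr ⟨h, rfl⟩)⟩
  · rintro ⟨h1, h2⟩
    ext q
    simp [hS, h1, h2]

variable {r s : ℕ}

theorem rect_ext_iff {p q : Rect r s} : p = q ↔ p.1.val = q.1.val ∧ p.2.val = q.2.val := by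
  rw [Prod.ext_iff, Subtype.ext_iff, Subtype.ext_iff]

theorem rect_covBy_iff {q p : Rect r s} : q ⋖ p ↔
    (q.1.val + 1 = p.1.val ∧ q.2.val = p.2.val) ∨
      (q.1.val = p.1.val ∧ q.2.val + 1 = p.2.val) := by
  obtain ⟨⟨q1, hq1⟩, ⟨q2, hq2⟩⟩ := q
  obtain ⟨⟨p1, hp1⟩, ⟨p2, hp2⟩⟩ := p
  have key : ∀ {n a b : ℕ} (ha : a ∈ Set.Icc 1 n) (hb : b ∈ Set.Icc 1 n),
      (⟨a, ha⟩ : Set.Icc 1 n) ⋖ ⟨b, hb⟩ ↔ a + 1 = b := by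
    intro n a b ha hb
    constructor
    · intro h
      have h1 : a < b := h.lt
      by_contra hne
      exact h.2 (c := ⟨a + 1, by have := hb.2; constructor <;> omega⟩)
        (Subtype.mk_lt_mk.2 (by omega)) (Subtype.mk_lt_mk.2 (by omega))
    · rintro rfl
      refine ⟨Subtype.mk_lt_mk.2 (by omega), ?_⟩
      rintro ⟨c, hc⟩ h1 h2
      rw [Subtype.mk_lt_mk] at h1 h2
      omega
  rw [Prod.mk_covBy_mk_iff, key, key, Subtype.mk.injEq, Subtype.mk.injEq]
  tauto

theorem rect_fst_lt (p : Rect r s) : p.1.val - 1 < r := by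
  have h := Set.mem_Icc.1 p.1.2
  omega

theorem rect_snd_lt (p : Rect r s) : p.2.val - 1 < s := by
  have h := Set.mem_Icc.1 p.2.2
  omega

/-- The labeling of the rectangle given by a function of the coordinates counted from `0`. -/
def ofCoord (F : ℕ → ℕ → ℝ) (hF : ∀ i < r, ∀ j < s, 0 < F i j) : Labeling (Rect r s) :=
  ⟨fun p => F (p.1 - 1) (p.2 - 1), fun p => hF _ (rect_fst_lt p) _ (rect_snd_lt p)⟩

theorem sumOne_lowerCovers (F : ℕ → ℕ → ℝ) (p : Rect r s) :
    sumOne (lowerCovers p) (fun q => F (q.1 - 1) (q.2 - 1)) = lowerSum F (p.1 - 1) (p.2 - 1) := by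
  obtain ⟨⟨p1, h11, h12⟩, ⟨p2, h21, h22⟩⟩ := p
  have hS : ∀ q : Rect r s, q ∈ lowerCovers (⟨⟨p1, h11, h12⟩, ⟨p2, h21, h22⟩⟩ : Rect r s) ↔
      (∃ h : 0 < p1 - 1, q = (⟨⟨p1 - 1, by omega, by omega⟩, ⟨p2, h21, h22⟩⟩ : Rect r s)) ∨
      ∃ h : 0 < p2 - 1, q = (⟨⟨p1, h11, h12⟩, ⟨p2 - 1, by omega, by omega⟩⟩ : Rect r s) := by
    intro q
    have := q.1.2.1
    have := q.2.2.1
    rw [mem_lowerCovers, rect_covBy_iff]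
    simp only [rect_ext_iff, exists_prop]
    omega
  rw [sumOne, lowerSum, sum_of_two_points _ _ hS (fun h h' e => by
    rw [rect_ext_iff] at e; simp only at e; omega)]
  have he := eq_empty_of_two_points _ _ hS
  by_cases hc : p1 - 1 = 0 ∧ p2 - 1 = 0
  · rw [if_pos (he.2 (by omega)), if_pos hc]
  · rw [if_neg fun h => hc (by have := he.1 h; omega), if_neg hc]
    simp only [dite_eq_ite]

theorem parSumOne_upperCovers (F : ℕ → ℕ → ℝ) (p : Rect r s) :
    parSumOne (upperCovers p) (fun q => F (q.1 - 1) (q.2 - 1))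
      = (upperSum r s F (p.1 - 1) (p.2 - 1))⁻¹ := by
  obtain ⟨⟨p1, h11, h12⟩, ⟨p2, h21, h22⟩⟩ := p
  have hS : ∀ q : Rect r s, q ∈ upperCovers (⟨⟨p1, h11, h12⟩, ⟨p2, h21, h22⟩⟩ : Rect r s) ↔
      (∃ h : p1 - 1 + 1 < r, q =
        (⟨⟨p1 - 1 + 1 + 1, by omega, by omega⟩, ⟨p2, h21, h22⟩⟩ : Rect r s)) ∨
      ∃ h : p2 - 1 + 1 < s, q =
        (⟨⟨p1, h11, h12⟩, ⟨p2 - 1 + 1 + 1, by omega, by omega⟩⟩ : Rect r s) := by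
    intro q
    have := q.1.2.2
    have := q.2.2.2
    rw [mem_upperCovers, rect_covBy_iff]
    simp only [rect_ext_iff, exists_prop]
    omega
  rw [parSumOne, upperSum, sum_of_two_points _ _ hS (fun h h' e => by
    rw [rect_ext_iff] at e; simp only at e; omega), apply_ite (fun z : ℝ => z⁻¹), inv_one]
  have he := eq_empty_of_two_points _ _ hS
  by_cases hc : p1 - 1 + 1 = r ∧ p2 - 1 + 1 = s
  · rw [if_pos (he.2 (by omega)), if_pos hc]
  · rw [if_neg fun h => hc (by have := he.1 h; omega), if_neg hc]
    simp only [dite_eq_ite, Nat.add_sub_cancel]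

/-- Rowmotion in terms of coordinates. -/
theorem rowmotion_ofCoord (L : LinExt (Rect r s)) {F G : ℕ → ℕ → ℝ}
    (hF : ∀ i < r, ∀ j < s, 0 < F i j) (hG : ∀ i < r, ∀ j < s, 0 < G i j)
    (h : ∀ i < r, ∀ j < s, G i j * F i j * upperSum r s G i j = lowerSum F i j) :
    rowmotion L (ofCoord F hF) = ofCoord G hG := by
  refine rowmotion_eq_of_forall L fun p => ?_
  have h1 : p.1.val - 1 < r := rect_fst_lt p
  have h2 : p.2.val - 1 < s := rect_snd_lt p
  have hpar := parSumOne_pos (upperCovers p) (ofCoord G hG).2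
  simp only [ofCoord] at hpar ⊢
  rw [parSumOne_upperCovers] at hpar ⊢
  rw [sumOne_lowerCovers, ← h _ h1 _ h2]
  have hF' := (hF _ h1 _ h2).ne'
  have hu := (inv_pos.1 hpar).ne'
  field_simp

end Rect

/-! ### Disjoint paths and minors -/

/-- The positions at the times `0, …, r` of a path that starts at position `m` and ends at position
`n`. A path is frozen while it is outside of the `s` columns. -/
structure IsTrack (r s m n : ℕ) (p : ℕ → ℕ) : Prop where
  start : p 0 = m
  finish : p r = n
  step : ∀ t < r, p (t + 1) = p t ∨ (p (t + 1) = p t + 1 ∧ t ≤ p t ∧ p t < t + s)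

/-- The vertices in `G_R` of the path with positions `p`: its part inside of the columns. It enters
the columns at time `m + 1 - s` (truncated at `0`) and leaves them after time `min n r`. -/
def trackList (r s m n : ℕ) (p : ℕ → ℕ) : List (ℕ × ℕ) :=
  (List.range' (m + 1 - s) (min n r + 1 - (m + 1 - s))).map fun t => (t + 1, p t - t + 1)

section Track

variable {r s m n : ℕ} {p : ℕ → ℕ}

theorem IsTrack.eq_start (h : IsTrack r s m n p) {t : ℕ} (ht : t ≤ r) (hp : t + s ≤ p t) :
    p t = m := by
  induction t with
  | zero => exact h.start
  | succ t ih =>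
    rcases h.step t (by omega) with e | ⟨e, -, h3⟩
    · rw [e, ih (by omega) (by omega)]
    · omega

theorem IsTrack.eq_start_of_le (h : IsTrack r s m n p) {t : ℕ} (ht : t ≤ r) (hm : t + s ≤ m) :
    p t = m := by
  induction t with
  | zero => exact h.start
  | succ t ih =>
    have := ih (by omega) (by omega)
    rcases h.step t (by omega) with e | ⟨e, -, h3⟩ <;> omega

theorem IsTrack.lt_add_iff (h : IsTrack r s m n p) {t : ℕ} (ht : t ≤ r) :
    p t < t + s ↔ m < t + s := by
  constructor
  · intro h1
    by_contra! h2
    rw [h.eq_start_of_le ht h2] at h1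
    omega
  · intro h1
    by_contra! h2
    rw [h.eq_start ht h2] at h2
    omega

theorem IsTrack.eq_finish (h : IsTrack r s m n p) {t : ℕ} (ht : t ≤ r) (hp : p t < t) :
    p t = n := by
  have key : ∀ d, t + d ≤ r → p (t + d) = p t := by
    intro d
    induction d with
    | zero => simp
    | succ d ih =>
      intro hd
      have := ih (by omega)
      rw [← add_assoc]
      rcases h.step (t + d) (by omega) with e | ⟨e, h2, -⟩ <;> omega
  have := key (r - t) (by omega)
  rw [Nat.add_sub_cancel' ht, h.finish] at this
  exact this.symm

theorem IsTrack.eq_finish_of_lt (h : IsTrack r s m n p) {t : ℕ} (ht : t ≤ r) (hn : n < t) :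
    p t = n := by
  have key : ∀ d, d ≤ r → n < r - d → p (r - d) = n := by
    intro d
    induction d with
    | zero => intro _ _; exact h.finish
    | succ d ih =>
      intro hd hn
      have := ih (by omega) (by omega)
      rcases h.step (r - (d + 1)) (by omega) with e | ⟨e, h2, -⟩ <;>
        rw [show r - (d + 1) + 1 = r - d by omega] at e <;> omega
  have := key (r - t) (by omega) (by omega)
  rwa [Nat.sub_sub_self ht] at this

theorem IsTrack.le_iff (h : IsTrack r s m n p) {t : ℕ} (ht : t ≤ r) : t ≤ p t ↔ t ≤ n := by
  constructor
  · intro h1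
    by_contra! h2
    rw [h.eq_finish_of_lt ht h2] at h1
    omega
  · intro h1
    by_contra! h2
    rw [h.eq_finish ht h2] at h2
    omega

theorem mem_trackList {u : ℕ × ℕ} : u ∈ trackList r s m n p ↔
    ∃ t, m < t + s ∧ t ≤ n ∧ t ≤ r ∧ u = (t + 1, p t - t + 1) := by
  simp only [trackList, List.mem_map, List.mem_range'_1]
  constructor
  · rintro ⟨t, ht, rfl⟩
    exact ⟨t, by omega, by omega, by omega, rfl⟩
  · rintro ⟨t, h1, h2, h3, rfl⟩
    exact ⟨t, by omega, rfl⟩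

theorem startPt_succ (hs : 1 ≤ s) (m : ℕ) :
    startPt s (m + 1) = (m + 1 - s + 1, m - (m + 1 - s) + 1) := by
  unfold startPt
  split_ifs <;> (ext <;> simp only <;> omega)

theorem endPt_succ (r n : ℕ) : endPt r (n + 1) = (min n r + 1, n - min n r + 1) := by
  unfold endPt
  split_ifs <;> (ext <;> simp only <;> omega)

theorem IsTrack.le (h : IsTrack r s m n p) : m ≤ n := by
  have key : ∀ t ≤ r, m ≤ p t := by
    intro t ht
    induction t with
    | zero => rw [h.start]
    | succ t ih =>
      have := ih (by omega)
      rcases h.step t (by omega) with e | ⟨e, -, -⟩ <;> omega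
  rw [← h.finish]
  exact key r le_rfl

/-- Tracks are paths in `G_R`. -/
theorem IsTrack.isPath (h : IsTrack r s m n p) (hs : 1 ≤ s) (hm : m < r + s) :
    IsPath r s (startPt s (m + 1)) (endPt r (n + 1)) (trackList r s m n p) := by
  have hmn := h.le
  obtain ⟨d, hd⟩ : ∃ d, min n r + 1 - (m + 1 - s) = d + 1 :=
    ⟨min n r - (m + 1 - s), by omega⟩
  refine ⟨?_, ?_, ?_, ?_⟩
  · intro u hu
    obtain ⟨t, h1, h2, h3, rfl⟩ := mem_trackList.1 hu
    have h4 := (h.lt_add_iff h3).2 h1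
    simp only [vertices, Finset.mem_product, Finset.mem_Icc]
    omega
  · rw [List.isChain_iff_getElem]
    intro u hu
    simp only [trackList, List.length_map, List.length_range'] at hu
    simp only [trackList, List.getElem_map, List.getElem_range', one_mul]
    have h1 := (h.le_iff (t := m + 1 - s + u) (by omega)).2 (by omega)
    have h2 := (h.le_iff (t := m + 1 - s + u + 1) (by omega)).2 (by omega)
    rw [show m + 1 - s + (u + 1) = m + 1 - s + u + 1 from rfl]
    rcases h.step (m + 1 - s + u) (by omega) with e | ⟨e, -, -⟩
    · right
      rw [e] at h2 ⊢
      exact ⟨rfl, by simp only; omega⟩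
    · left
      rw [e]
      exact Prod.ext rfl (by simp only; omega)
  · have h0 : p (m + 1 - s) = m := by
      rcases Nat.lt_or_ge m s with hc | hc
      · rw [show m + 1 - s = 0 by omega]; exact h.start
      · have h1 := h.eq_start_of_le (t := m - s) (by omega) (by omega)
        rcases h.step (m - s) (by omega) with e | ⟨e, -, h3⟩
        · rw [show m + 1 - s = m - s + 1 by omega, e, h1]
        · omega
    rw [trackList, hd, startPt_succ hs]
    simp [List.range'_succ, h0]
  · have h0 : p (min n r) = n := by
      rcases Nat.lt_or_ge n r with hc | hc
      · rw [min_eq_left hc.le]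
        have h1 := h.eq_finish_of_lt (t := n + 1) (by omega) (by omega)
        have h2 := (h.le_iff (t := n) (by omega)).2 le_rfl
        rcases h.step n (by omega) with e | ⟨e, -, h3⟩ <;> omega
      · rw [min_eq_right hc]; exact h.finish
    rw [trackList, hd, endPt_succ, List.range'_1_concat, List.map_append]
    have e : m + 1 - s + d = min n r := by omega
    simp [e, h0]

/-- Every path in `G_R` is a track. -/
theorem exists_isTrack {l : List (ℕ × ℕ)} (hs : 1 ≤ s)
    (hl : IsPath r s (startPt s (m + 1)) (endPt r (n + 1)) l) :
    ∃ p, IsTrack r s m n p ∧ trackList r s m n p = l := by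
  rw [startPt_succ hs, endPt_succ] at hl
  obtain ⟨hv, hc, hh, hla⟩ := hl
  rw [List.isChain_iff_getElem] at hc
  have hpos : 0 < l.length := by
    rcases l with _ | ⟨a, l⟩
    · simp at hh
    · simp
  have h0 : l[0] = (m + 1 - s + 1, m - (m + 1 - s) + 1) := by
    rw [List.head?_eq_getElem?, List.getElem?_eq_getElem hpos] at hh
    exact Option.some.inj hh
  have h1 : l[l.length - 1] = (min n r + 1, n - min n r + 1) := by
    rw [List.getLast?_eq_getElem?, List.getElem?_eq_getElem (by omega)] at hla
    exact Option.some.inj hla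
  have hrow : ∀ u (hu : u < l.length), (l[u]).1 = m + 1 - s + u + 1 := by
    intro u
    induction u with
    | zero => intro _; rw [h0]
    | succ u ih =>
      intro hu
      have h2 := ih (by omega)
      rcases hc u hu with e | ⟨e, -⟩
      · rw [e, h2]; rfl
      · rw [e, h2]; rfl
  have hlen : m + 1 - s + l.length = min n r + 1 := by
    have h2 := hrow (l.length - 1) (by omega)
    rw [h1] at h2
    simp only at h2
    omega
  have hcol : ∀ u (hu : u < l.length), 1 ≤ (l[u]).2 ∧ (l[u]).2 ≤ s := by
    intro u hu
    have := hv _ (List.getElem_mem hu)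
    simp only [vertices, Finset.mem_product, Finset.mem_Icc] at this
    exact this.2
  let g : ℕ → ℕ := fun u => (l.getD u (0, 0)).2
  have hg : ∀ u (hu : u < l.length), g u = (l[u]).2 := fun u hu => by
    simp only [g]; rw [List.getD_eq_getElem _ _ hu]
  have g0 : g 0 = m - (m + 1 - s) + 1 := by rw [hg 0 hpos, h0]
  have g1 : g (l.length - 1) = n - min n r + 1 := by rw [hg _ (by omega), h1]
  have gstep : ∀ u, u + 1 < l.length → g (u + 1) = g u ∨ g (u + 1) + 1 = g u := by
    intro u hu
    rw [hg _ hu, hg u (by omega)]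
    rcases hc u hu with e | ⟨-, e⟩
    · left; rw [e]
    · right; exact e
  have gcol : ∀ u, u < l.length → 1 ≤ g u ∧ g u ≤ s := fun u hu => by
    rw [hg u hu]; exact hcol u hu
  have hm0 := (gcol 0 hpos).2
  have hn0 := (gcol (l.length - 1) (by omega)).2
  let p : ℕ → ℕ := fun t => if t < m + 1 - s then m else if min n r < t then n
    else g (t - (m + 1 - s)) + t - 1
  have pa : ∀ t, t < m + 1 - s → p t = m := fun t ht => if_pos ht
  have pb : ∀ t, min n r < t → p t = n := fun t ht => by
    simp only [p]; rw [if_neg (by omega), if_pos ht]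
  have pc : ∀ u, u < l.length → p (m + 1 - s + u) = g u + (m + 1 - s + u) - 1 := fun u hu => by
    simp only [p]
    rw [if_neg (by omega), if_neg (by omega), Nat.add_sub_cancel_left]
  have p0 : p (m + 1 - s) = m := by
    have := pc 0 hpos
    rw [add_zero, g0] at this
    omega
  have p1 : p (min n r) = n := by
    have := pc (l.length - 1) (by omega)
    rw [g1, show m + 1 - s + (l.length - 1) = min n r by omega] at this
    omega
  refine ⟨p, ⟨?_, ?_, ?_⟩, ?_⟩
  · rcases Nat.eq_zero_or_pos (m + 1 - s) with e | e
    · rw [e] at p0; exact p0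
    · exact pa 0 e
  · rcases lt_or_ge (min n r) r with e | e
    · exact pb r e
    · rw [show min n r = r by omega] at p1; exact p1
  · intro t ht
    rcases lt_or_ge t (m + 1 - s) with c1 | c1
    · left
      rw [pa t c1]
      rcases lt_or_ge (t + 1) (m + 1 - s) with c2 | c2
      · exact pa _ c2
      · rw [show t + 1 = m + 1 - s by omega]; exact p0
    · rcases le_or_gt (min n r) t with c2 | c2
      · left
        rw [pb (t + 1) (by omega)]
        rcases c2.eq_or_lt with c3 | c3
        · rw [← c3]; exact p1.symm
        · exact (pb t c3).symm
      · obtain ⟨u, rfl⟩ := Nat.exists_eq_add_of_le c1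
        have e1 := pc u (by omega)
        have e2 := pc (u + 1) (by omega)
        rw [← add_assoc] at e2
        have := gcol u (by omega)
        have := gcol (u + 1) (by omega)
        rcases gstep u (by omega) with e | e
        · right; omega
        · left; omega
  · refine List.ext_getElem ?_ ?_
    · simp only [trackList, List.length_map, List.length_range']
      omega
    · intro u h2 h3
      simp only [trackList, List.getElem_map, List.getElem_range', one_mul]
      have e1 := pc u h3
      have := gcol u h3
      ext
      · rw [hrow u h3]
      · rw [← hg u h3]
        simp only
        omega

/-- A path determines its track. -/
theorem IsTrack.eq_of_trackList_eq {q : ℕ → ℕ} (hp : IsTrack r s m n p) (hq : IsTrack r s m n q)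
    (h : trackList r s m n p = trackList r s m n q) {t : ℕ} (ht : t ≤ r) : p t = q t := by
  rcases le_or_gt (t + s) m with c1 | c1
  · rw [hp.eq_start_of_le ht c1, hq.eq_start_of_le ht c1]
  rcases lt_or_ge n t with c2 | c2
  · rw [hp.eq_finish_of_lt ht c2, hq.eq_finish_of_lt ht c2]
  have h1 : (t + 1, p t - t + 1) ∈ trackList r s m n q :=
    h ▸ mem_trackList.2 ⟨t, c1, c2, ht, rfl⟩
  obtain ⟨t', -, -, -, e⟩ := mem_trackList.1 h1
  simp only [Prod.mk.injEq] at e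
  obtain ⟨e1, e2⟩ := e
  obtain rfl : t = t' := by omega
  have := (hp.le_iff ht).2 c2
  have := (hq.le_iff ht).2 c2
  omega

end Track

section Weight

variable {r s m n : ℕ} {p : ℕ → ℕ}

/-- The weights of the vertical edges of `G_R`, with coordinates counted from `0`. -/
noncomputable def invEntry (x : Labeling (Rect r s)) (t c : ℕ) : ℝ := (entry x (t + 1) (c + 1))⁻¹

theorem entry_pos (x : Labeling (Rect r s)) (i j : ℕ) : 0 < entry x i j := by
  unfold entry
  split_ifs
  · exact x.2 _
  · exact one_pos

theorem invEntry_pos (x : Labeling (Rect r s)) (t c : ℕ) : 0 < invEntry x t c :=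
  inv_pos.2 (entry_pos x _ _)

theorem pathWeight_map_range' (x : Labeling (Rect r s)) (g : ℕ → ℕ × ℕ) (a d : ℕ) :
    pathWeight x ((List.range' a (d + 1)).map g)
      = ∏ u ∈ range d, edgeWeight x (g (a + u)) (g (a + u + 1)) := by
  induction d generalizing a with
  | zero => simp [pathWeight, List.range'_succ]
  | succ d ih =>
    rw [Finset.prod_range_succ', List.range'_succ, List.map_cons]
    have h := ih (a + 1)
    rw [List.range'_succ, List.map_cons] at h ⊢
    rw [pathWeight, h, mul_comm]
    simp only [add_zero, add_assoc, add_comm 1]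

theorem IsTrack.pathWeight_trackList (x : Labeling (Rect r s)) (h : IsTrack r s m n p)
    (hs : 1 ≤ s) (hm : m < r + s) : pathWeight x (trackList r s m n p)
      = ∏ t ∈ range r,
        if p (t + 1) = p t then 1 else rectWeight s (invEntry x) t (p t) := by
  have hmn := h.le
  obtain ⟨d, hd⟩ : ∃ d, min n r + 1 - (m + 1 - s) = d + 1 :=
    ⟨min n r - (m + 1 - s), by omega⟩
  have hsub : Finset.Ico (m + 1 - s) (m + 1 - s + d) ⊆ range r := by
    intro t ht
    rw [Finset.mem_Ico] at ht
    rw [Finset.mem_range]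
    omega
  rw [trackList, hd, pathWeight_map_range', ← Finset.prod_subset hsub,
    Finset.prod_Ico_eq_prod_range, Nat.add_sub_cancel_left]
  · refine Finset.prod_congr rfl fun u hu => ?_
    rw [Finset.mem_range] at hu
    have h1 := (h.le_iff (t := m + 1 - s + u) (by omega)).2 (by omega)
    have h2 := (h.le_iff (t := m + 1 - s + u + 1) (by omega)).2 (by omega)
    rcases h.step (m + 1 - s + u) (by omega) with e | ⟨e, -, h3⟩
    · rw [if_pos e, edgeWeight, if_neg]
      simp only
      omega
    · rw [if_neg (by omega), edgeWeight, if_pos (by simp only; omega), rectWeight,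
        if_pos ⟨h1, h3⟩, invEntry]
  · intro t ht htn
    rw [Finset.mem_range] at ht
    rw [Finset.mem_Ico, not_and_or] at htn
    refine if_pos ?_
    rcases h.step t ht with e | ⟨e, h2, h3⟩
    · exact e
    · have h4 := (h.lt_add_iff ht.le).1 h3
      have h5 := (h.le_iff (t := t + 1) ht).1 (by omega)
      omega

end Weight

section Families

variable {r s k : ℕ}

theorem positions_succ {d : ℕ} (I : Fin k → ℕ) (E : Fin d → Finset (Fin k)) (u : Fin d)
    (c : Fin k) : positions I E (u + 1) c = positions I E u c + if c ∈ E u then 1 else 0 := by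
  have h : ∀ v : Fin d, (if v.val < u.val + 1 ∧ c ∈ E v then 1 else 0)
      = (if v.val < u.val ∧ c ∈ E v then 1 else 0)
        + if v = u then (if c ∈ E u then 1 else 0) else 0 := by
    intro v
    rcases lt_trichotomy v u with hv | rfl | hv
    · simp [hv.ne, show v.val < u.val from hv, show v.val < u.val + 1 from Nat.lt_succ_of_lt hv]
    · simp
    · simp [hv.ne', show ¬ v.val < u.val from not_lt.2 (le_of_lt hv),
        show ¬ v.val < u.val + 1 from not_lt.2 hv]
  simp only [positions, h, Finset.sum_add_distrib, Finset.sum_ite_eq', Finset.mem_univ, if_true,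
    add_assoc]

/-- Noncolliding paths with consecutive starting points and consecutive end points keep their
order. -/
theorem strictMono_tracks {i j : ℕ} {σ : Equiv.Perm (Fin k)} {p : Fin k → ℕ → ℕ}
    (hp : ∀ a : Fin k, IsTrack r s (i + a) (j + σ a) (p a))
    (hdis : ∀ a b : Fin k, a ≠ b → List.Disjoint (trackList r s (i + a) (j + σ a) (p a))
      (trackList r s (i + b) (j + σ b) (p b))) {t : ℕ} (ht : t ≤ r) :
    StrictMono fun a => p a t := by
  have hne : ∀ a b, a ≠ b → ∀ t ≤ r, p a t ≠ p b t := by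
    intro a b hab t ht e
    rcases lt_or_ge (p a t) (t + s) with c1 | c1
    · rcases lt_or_ge (p a t) t with c2 | c2
      · have e1 := (hp a).eq_finish ht c2
        have e2 := (hp b).eq_finish ht (e ▸ c2)
        exact hab (σ.injective (Fin.ext (by omega)))
      · exact @hdis a b hab (t + 1, p a t - t + 1)
          (mem_trackList.2 ⟨t, ((hp a).lt_add_iff ht).1 c1, ((hp a).le_iff ht).1 c2, ht, rfl⟩)
          (mem_trackList.2 ⟨t, ((hp b).lt_add_iff ht).1 (e ▸ c1), ((hp b).le_iff ht).1 (e ▸ c2),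
            ht, by rw [e]⟩)
    · have e1 := (hp a).eq_start ht c1
      have e2 := (hp b).eq_start ht (e ▸ c1)
      exact hab (Fin.ext (by omega))
  induction t with
  | zero =>
    intro a b hab
    change p a 0 < p b 0
    rw [(hp a).start, (hp b).start]
    exact Nat.add_lt_add_left hab i
  | succ t ih =>
    intro a b hab
    have h1 : p a t < p b t := ih (by omega) hab
    have h2 := hne a b hab.ne (t + 1) ht
    change p a (t + 1) < p b (t + 1)
    rcases (hp a).step t ht with e | ⟨e, -, -⟩ <;> rcases (hp b).step t ht with e' | ⟨e', -, -⟩ <;>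
      omega

/-- **Lindström–Gessel–Viennot** for `G_R`: the total weight of the families of disjoint paths is a
minor of the matrix of path weights. -/
theorem W_succ_succ (x : Labeling (Rect r s)) (hs : 1 ≤ s) {i j : ℕ} (hi : i + k ≤ r + s) :
    W x k (i + 1) (j + 1) =
      solidMinor (stepMatrix (rectWeight s (invEntry x)) r 0) k i j := by
  classical
  have hmin : solidMinor (stepMatrix (rectWeight s (invEntry x)) r 0) k i j
      = stepMinor (rectWeight s (invEntry x)) r 0 (fun c : Fin k => i + c)
          (fun c : Fin k => j + c) := rfl
  rw [hmin, stepMinor_eq_sum (strictMono_add_val _ _) (strictMono_add_val _ _),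
    ← Finset.sum_filter]
  set I : Fin k → ℕ := fun c => i + c with hI
  -- Only the families in which all moves take place inside of the columns contribute.
  let good : (Fin r → Finset (Fin k)) → Prop := fun E => ∀ u : Fin r, ∀ c ∈ E u,
    u.val ≤ positions I E u c ∧ positions I E u c < u.val + s
  rw [← Finset.sum_filter_of_ne (p := good)]
  swap
  · intro E _ hE u c hc
    by_contra hcon
    refine hE (Finset.prod_eq_zero (Finset.mem_univ u) (Finset.prod_eq_zero hc ?_))
    rw [zero_add, rectWeight, if_neg hcon]
  have htrack : ∀ E : Fin r → Finset (Fin k), good E →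
      positions I E r = (fun c : Fin k => j + c) →
      ∀ a : Fin k, IsTrack r s (i + a) (j + a) (fun t => positions I E t a) := by
    intro E hE hfin a
    refine ⟨by rw [positions_zero], by rw [hfin], fun t ht => ?_⟩
    have h1 := positions_succ I E ⟨t, ht⟩ a
    simp only at h1
    rw [h1]
    split_ifs with hc
    · exact Or.inr ⟨rfl, hE ⟨t, ht⟩ a hc⟩
    · exact Or.inl rfl
  symm
  refine Finset.sum_bij (fun E _ a => trackList r s (i + a) (j + a) fun t => positions I E t a)
    ?_ ?_ ?_ ?_
  · intro E hE
    simp only [Finset.mem_filter, Finset.mem_univ, true_and] at hE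
    obtain ⟨⟨hmono, hfin⟩, hgood⟩ := hE
    rw [Set.Finite.mem_toFinset]
    refine ⟨⟨1, fun a => ?_⟩, fun a b hab => ?_⟩
    · rw [Equiv.Perm.one_apply, show i + 1 + a.val = i + a + 1 by omega,
        show j + 1 + a.val = j + a + 1 by omega]
      exact (htrack E hgood hfin a).isPath hs (by omega)
    · intro u hu hu'
      obtain ⟨t, -, h2, h3, rfl⟩ := mem_trackList.1 hu
      obtain ⟨t', -, h2', -, e⟩ := mem_trackList.1 hu'
      simp only [Prod.mk.injEq] at e
      obtain rfl : t = t' := by omega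
      have h4 := ((htrack E hgood hfin a).le_iff h3).2 h2
      have h5 := ((htrack E hgood hfin b).le_iff h3).2 h2'
      exact hab ((hmono t h3).injective (by omega))
  · intro E hE E' hE' heq
    simp only [Finset.mem_filter, Finset.mem_univ, true_and] at hE hE'
    have key : ∀ a, ∀ t ≤ r, positions I E t a = positions I E' t a := fun a t ht =>
      (htrack E hE.2 hE.1.2 a).eq_of_trackList_eq (htrack E' hE'.2 hE'.1.2 a) (congrFun heq a) ht
    funext u
    ext a
    have h1 := positions_succ I E u a
    have h2 := positions_succ I E' u a
    rw [key a _ u.2, key a u u.2.le, h2] at h1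
    by_cases c1 : a ∈ E u <;> by_cases c2 : a ∈ E' u <;> simp_all
  · intro f hf
    rw [Set.Finite.mem_toFinset] at hf
    obtain ⟨⟨σ, hσ⟩, hdis⟩ := hf
    have hex : ∀ a : Fin k, ∃ p, IsTrack r s (i + a) (j + σ a) p ∧
        trackList r s (i + a) (j + σ a) p = f a := fun a => by
      refine exists_isTrack hs ?_
      have := hσ a
      rwa [show i + 1 + a.val = i + a + 1 by omega,
        show j + 1 + (σ a).val = j + σ a + 1 by omega] at this
    choose p hp hpf using hex
    have hmono : ∀ t ≤ r, StrictMono fun a => p a t := fun t ht =>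
      strictMono_tracks hp (fun a b hab => by rw [hpf, hpf]; exact hdis a b hab) ht
    have hσ1 : ∀ a, σ a = a := by
      have h1 : StrictMono σ := fun a b hab => by
        have := hmono r le_rfl hab
        simp only [(hp a).finish, (hp b).finish] at this
        exact Fin.lt_def.2 (by omega)
      have h2 := (h1.range_inj strictMono_id).1 (by rw [σ.surjective.range_eq, Set.range_id])
      exact fun a => congrFun h2 a
    let E : Fin r → Finset (Fin k) := fun u => univ.filter fun a => p a (u + 1) ≠ p a u
    have hpos : ∀ t ≤ r, ∀ a, positions I E t a = p a t := by
      intro t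
      induction t with
      | zero => intro _ a; rw [positions_zero, (hp a).start]
      | succ t ih =>
        intro ht a
        have h1 := positions_succ I E ⟨t, ht⟩ a
        simp only at h1
        rw [h1, ih (by omega) a]
        simp only [E, Finset.mem_filter, Finset.mem_univ, true_and]
        rcases (hp a).step t ht with e | ⟨e, -, -⟩ <;> simp [e]
    refine ⟨E, ?_, ?_⟩
    · simp only [Finset.mem_filter, Finset.mem_univ, true_and]
      refine ⟨⟨fun u hu => ?_, ?_⟩, fun u c hc => ?_⟩
      · have : positions I E u = fun a => p a u := funext (hpos u hu)
        rw [this]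
        exact hmono u hu
      · funext a
        rw [hpos r le_rfl, (hp a).finish, hσ1]
      · simp only [E, Finset.mem_filter, Finset.mem_univ, true_and] at hc
        rw [hpos u u.2.le]
        rcases (hp c).step u u.2 with e | ⟨-, e⟩
        · exact absurd e hc
        · exact e
    · funext a
      rw [← hpf a, hσ1]
      simp only [trackList]
      refine List.map_congr_left fun t ht => ?_
      rw [List.mem_range'_1] at ht
      rw [hpos t (by omega)]
  · intro E hE
    simp only [Finset.mem_filter, Finset.mem_univ, true_and] at hE
    have h1 : ∀ a : Fin k, pathWeight x (trackList r s (i + a) (j + a) fun t => positions I E t a)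
        = ∏ u : Fin r, if a ∈ E u then
          rectWeight s (invEntry x) (0 + u) (positions I E u a) else 1 := by
      intro a
      rw [(htrack E hE.2 hE.1.2 a).pathWeight_trackList x hs (by omega),
        ← Fin.prod_univ_eq_prod_range (fun t => if positions I E (t + 1) a = positions I E t a
          then 1 else rectWeight s (invEntry x) t (positions I E t a)) r]
      refine Finset.prod_congr rfl fun u _ => ?_
      rw [positions_succ]
      by_cases hc : a ∈ E u <;> simp [hc]
    simp only [h1]
    rw [Finset.prod_comm]
    refine Finset.prod_congr rfl fun u _ => ?_
    rw [Finset.prod_ite_mem, Finset.univ_inter]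

end Families

/-! ### The array of path weights and the rowmotion orbit -/

section SolidMinors

variable {r s : ℕ}

theorem IsPath.head_mem {u v : ℕ × ℕ} {l : List (ℕ × ℕ)} (h : IsPath r s u v l) :
    u ∈ vertices r s :=
  h.mem_vertices u (List.mem_of_mem_head? h.head)

theorem IsPath.last_mem {u v : ℕ × ℕ} {l : List (ℕ × ℕ)} (h : IsPath r s u v l) :
    v ∈ vertices r s :=
  h.mem_vertices v (List.mem_of_mem_getLast? h.last)

theorem startPt_mem {m : ℕ} (h : startPt s m ∈ vertices r s) : 1 ≤ m ∧ m ≤ r + s := by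
  unfold startPt at h
  simp only [vertices, Finset.mem_product, Finset.mem_Icc] at h
  split_ifs at h <;> simp only at h <;> omega

theorem endPt_mem {m : ℕ} (h : endPt r m ∈ vertices r s) : 1 ≤ m ∧ m ≤ r + s := by
  unfold endPt at h
  simp only [vertices, Finset.mem_product, Finset.mem_Icc] at h
  split_ifs at h <;> simp only at h <;> omega

theorem W_eq_zero_of_start (x : Labeling (Rect r s)) {k i j : ℕ} (a : Fin k)
    (h : ¬ (1 ≤ i + a.val ∧ i + a.val ≤ r + s)) : W x k i j = 0 := by
  refine Finset.sum_eq_zero fun f hf => ?_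
  rw [Set.Finite.mem_toFinset] at hf
  obtain ⟨⟨σ, hσ⟩, -⟩ := hf
  exact absurd (startPt_mem (hσ a).head_mem) h

theorem W_eq_zero_of_end (x : Labeling (Rect r s)) {k i j : ℕ} (a : Fin k)
    (h : ¬ (1 ≤ j + a.val ∧ j + a.val ≤ r + s)) : W x k i j = 0 := by
  refine Finset.sum_eq_zero fun f hf => ?_
  rw [Set.Finite.mem_toFinset] at hf
  obtain ⟨⟨σ, hσ⟩, -⟩ := hf
  have := (hσ (σ.symm a)).last_mem
  rw [Equiv.apply_symm_apply] at this
  exact absurd (endPt_mem this) h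

theorem W_zero (x : Labeling (Rect r s)) (i j : ℕ) : W x 0 i j = 1 := by
  have h : pathFamilies r s 0 i j = {fun a => a.elim0} := by
    ext f
    simp only [Set.mem_singleton_iff]
    refine ⟨fun _ => funext fun a => a.elim0, ?_⟩
    rintro rfl
    exact ⟨⟨1, fun a => a.elim0⟩, fun a => a.elim0⟩
  simp [W, h]

/-- `W` is the array of solid minors of the matrix of path weights, also when some of the indices
are not in `[r + s]`. -/
theorem W_eq_solidMinor (hs : 1 ≤ s) (x : Labeling (Rect r s)) (k i j : ℕ) :
    W x k i j = solidMinor (W x 1) k i j := by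
  by_cases h1 : ∃ a : Fin k, ¬ (1 ≤ i + a.val ∧ i + a.val ≤ r + s)
  · obtain ⟨a, ha⟩ := h1
    rw [W_eq_zero_of_start x a ha]
    exact (Matrix.det_eq_zero_of_row_eq_zero a fun b =>
      W_eq_zero_of_start x 0 (by simpa using ha)).symm
  by_cases h2 : ∃ a : Fin k, ¬ (1 ≤ j + a.val ∧ j + a.val ≤ r + s)
  · obtain ⟨a, ha⟩ := h2
    rw [W_eq_zero_of_end x a ha]
    exact (Matrix.det_eq_zero_of_column_eq_zero a fun b =>
      W_eq_zero_of_end x 0 (by simpa using ha)).symm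
  push Not at h1 h2
  rcases k with _ | k
  · rw [W_zero]
    exact Matrix.det_isEmpty.symm
  have hi0 := h1 0
  have hj0 := h2 0
  have hi1 := h1 (Fin.last k)
  have hj1 := h2 (Fin.last k)
  simp only [Fin.val_zero, Fin.val_last, add_zero] at hi0 hj0 hi1 hj1
  obtain ⟨i, rfl⟩ : ∃ i', i = i' + 1 := ⟨i - 1, by omega⟩
  obtain ⟨j, rfl⟩ : ∃ j', j = j' + 1 := ⟨j - 1, by omega⟩
  rw [W_succ_succ x hs (by omega), solidMinor, solidMinor]
  congr 1
  ext a b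
  simp only [Matrix.of_apply]
  rw [show i + 1 + a.val = i + a + 1 by omega, show j + 1 + b.val = j + b + 1 by omega,
    W_succ_succ x hs (by omega), solidMinor, Matrix.det_fin_one]
  rfl

end SolidMinors

section Orbit

variable {r s : ℕ}

/-- The orbit of `transfer.symm x` under inverse rowmotion, indexed by the integers. -/
noncomputable def orbit (hr : 1 ≤ r) (x : Labeling (Rect r s)) (k : ℤ) : Labeling (Rect r s) :=
  ofCoord (orbitLabel r s (invEntry x) (k % (r + s : ℕ)).toNat) fun _ hi _ hj =>
    orbitLabel_pos (invEntry_pos x) hi hj (by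
      have := Int.emod_lt_of_pos k (b := (r + s : ℕ)) (by omega)
      have := Int.emod_nonneg k (b := (r + s : ℕ)) (by omega)
      omega)

theorem orbit_apply (hr : 1 ≤ r) (x : Labeling (Rect r s)) {k : ℤ} {l : ℕ}
    (h : k % (r + s : ℕ) = l) (p : Rect r s) :
    (orbit hr x k).val p = orbitLabel r s (invEntry x) l (p.1 - 1) (p.2 - 1) := by
  change orbitLabel r s (invEntry x) (k % (r + s : ℕ)).toNat (p.1 - 1) (p.2 - 1) = _
  rw [h, Int.toNat_natCast]

theorem orbit_add_period (hr : 1 ≤ r) (x : Labeling (Rect r s)) (k : ℤ) :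
    orbit hr x (k - (r + s : ℕ)) = orbit hr x k := by
  unfold orbit
  simp only [Int.sub_emod_right]

theorem rowmotion_orbit (L : LinExt (Rect r s)) (hr : 1 ≤ r) (x : Labeling (Rect r s)) (k : ℤ) :
    rowmotion L (orbit hr x (k + 1)) = orbit hr x k := by
  obtain ⟨l, hl⟩ : ∃ l : ℕ, k % (r + s : ℕ) = l :=
    ⟨_, (Int.toNat_of_nonneg (Int.emod_nonneg k (by omega))).symm⟩
  have hlt : l < r + s := by
    have := Int.emod_lt_of_pos k (b := (r + s : ℕ)) (by omega)
    omega
  refine rowmotion_ofCoord L _ _ fun i hi j hj => ?_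
  rw [hl, Int.toNat_natCast]
  rcases Nat.lt_or_ge (l + 1) (r + s) with h | h
  · have e : (k + 1) % (r + s : ℕ) = (l + 1 : ℕ) := by
      rw [Int.add_emod, hl, Int.add_emod_emod]
      rw [← Nat.cast_one, ← Nat.cast_add, ← Int.natCast_mod, Nat.mod_eq_of_lt h]
    rw [e, Int.toNat_natCast]
    exact orbitLabel_mul_upperSum (invEntry_pos x) hi hj h
  · have e : (k + 1) % (r + s : ℕ) = 0 := by
      rw [Int.add_emod, hl, Int.add_emod_emod]
      rw [← Nat.cast_one, ← Nat.cast_add, show l + 1 = r + s by omega, Int.emod_self]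
    rw [e, Int.toNat_zero]
    exact orbitLabel_mul_upperSum_last (invEntry_pos x) hi hj (by omega)

theorem orbit_zero (hr : 1 ≤ r) (x : Labeling (Rect r s)) : orbit hr x 0 = transfer.symm x := by
  rw [Equiv.eq_symm_apply]
  apply Subtype.ext
  funext p
  have h0 := minorRatio_zero (invEntry_pos x) (rect_fst_lt p) (rect_snd_lt p)
  have hi := Set.mem_Icc.1 p.1.2
  have hj := Set.mem_Icc.1 p.2.2
  have hlow : sumOne (lowerCovers p) (orbit hr x 0).val
      = lowerSum (minorRatio r s (invEntry x) 0) (p.1 - 1) (p.2 - 1) :=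
    (sumOne_lowerCovers (orbitLabel r s (invEntry x) 0) p).trans
      (lowerSum_congr (fun _ => orbitLabel_of_le (by omega)) fun _ => orbitLabel_of_le (by omega))
  have hpos := sumOne_pos (lowerCovers p) (orbit hr x 0).2
  change (orbit hr x 0).val p / sumOne (lowerCovers p) (orbit hr x 0).val = x.val p
  rw [hlow] at hpos ⊢
  rw [orbit_apply hr x (l := 0) (by simp), orbitLabel_of_le (by omega), h0,
    mul_div_cancel_right₀ _ hpos.ne', invEntry, inv_inv, Nat.sub_add_cancel hi.1,
    Nat.sub_add_cancel hj.1, entry, dif_pos ⟨p.1.2, p.2.2⟩]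

theorem rowmotion_zpow (L : LinExt (Rect r s)) (hr : 1 ≤ r) (x : Labeling (Rect r s)) (k : ℤ) :
    (rowmotion L ^ k) (transfer.symm x) = orbit hr x (-k) := by
  induction k with
  | zero => rw [zpow_zero, neg_zero, orbit_zero]; rfl
  | succ k ih =>
    rw [add_comm, zpow_add, zpow_one, Equiv.Perm.mul_apply, ih,
      show -(k : ℤ) = -(1 + k) + 1 by ring, rowmotion_orbit]
  | pred k ih =>
    rw [sub_eq_neg_add, zpow_add, zpow_neg_one, Equiv.Perm.mul_apply, ih,
      Equiv.Perm.inv_eq_iff_eq, show -(-1 + -(k : ℤ)) = - -(k : ℤ) + 1 by ring, rowmotion_orbit]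

/-- Reciprocity: the labels at `p` and at its antipode are inverse to each other, up to a shift in
time by the rank of `p`. -/
theorem orbit_antipode (hr : 1 ≤ r) (x : Labeling (Rect r s)) (p : Rect r s) (k : ℤ) :
    (orbit hr x k).val p = 1 / (orbit hr x (k + p.1.val + p.2.val - 1)).val (antipode p) := by
  have hi := Set.mem_Icc.1 p.1.2
  have hj := Set.mem_Icc.1 p.2.2
  obtain ⟨l, hl⟩ : ∃ l : ℕ, k % (r + s : ℕ) = l :=
    ⟨_, (Int.toNat_of_nonneg (Int.emod_nonneg k (by omega))).symm⟩
  have hlt : l < r + s := by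
    have := Int.emod_lt_of_pos k (b := (r + s : ℕ)) (by omega)
    omega
  have e : (k + p.1.val + p.2.val - 1) % (r + s : ℕ)
      = ((l + (p.1.val + p.2.val - 1)) % (r + s) : ℕ) := by
    rw [show k + p.1.val + p.2.val - 1 = k + ((p.1.val + p.2.val - 1 : ℕ) : ℤ) by omega,
      Int.add_emod, hl, Int.add_emod_emod]
    push_cast
    rfl
  have ea1 : (antipode p).1.val - 1 = r - 1 - (p.1.val - 1) := by simp only [antipode]; omega
  have ea2 : (antipode p).2.val - 1 = s - 1 - (p.2.val - 1) := by simp only [antipode]; omega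
  rw [orbit_apply hr x hl, orbit_apply hr x e, ea1, ea2, one_div]
  rcases Nat.lt_or_ge (l + (p.1.val + p.2.val - 1)) (r + s) with h | h
  · rw [Nat.mod_eq_of_lt h, orbitLabel_of_le (by omega),
      orbitLabel_eq_inv (l := l) (i' := p.1.val - 1) (j' := p.2.val - 1) (by omega) (by omega)
        (by omega), inv_inv]
  · have e2 : (l + (p.1.val + p.2.val - 1)) % (r + s) = l + (p.1.val + p.2.val - 1) - (r + s) := by
      rw [Nat.mod_eq_sub_mod h, Nat.mod_eq_of_lt (by omega)]
    rw [e2, orbitLabel_of_le (k := l + (p.1.val + p.2.val - 1) - (r + s)) (by omega)]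
    exact orbitLabel_eq_inv (by omega) (by omega) (by omega)

/-- Ratios of minors in terms of `W`, with coordinates counted from `1`. -/
theorem orbit_natCast (hr : 1 ≤ r) (hs : 1 ≤ s) (x : Labeling (Rect r s)) (p : Rect r s) {k : ℕ}
    (h : k + p.1.val + p.2.val ≤ r + s) : (orbit hr x k).val p =
      W x (p.2 - 1) (k + 2) (p.1 + k + 1) / W x p.2 (k + 1) (p.1 + k + 1) := by
  have hi := Set.mem_Icc.1 p.1.2
  have hj := Set.mem_Icc.1 p.2.2
  rw [orbit_apply hr x (l := k) (by rw [← Int.natCast_mod, Nat.mod_eq_of_lt (by omega)]),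
    orbitLabel_of_le (by omega), minorRatio, W_succ_succ x hs (by omega),
    W_succ_succ x hs (by omega), rectMinor, rectMinor, Nat.sub_add_cancel hi.1,
    Nat.sub_add_cancel hj.1, show k + 1 + (p.1.val - 1) = p.1.val + k by omega,
    add_comm k p.1.val]

end Orbit

section Order

theorem stepMatrix_succ_right (a : ℕ → ℕ → ℝ) (d t m : ℕ) :
    stepMatrix a d t m (m + 1) = ∑ u ∈ range d, a (t + u) m := by
  induction d generalizing t with
  | zero => simp [stepMatrix]
  | succ d ih =>
    rw [stepMatrix, ih, stepMatrix_self, Finset.sum_range_succ', mul_one]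
    simp only [add_zero, add_assoc, add_comm 1]

variable {r s : ℕ}

/-- The labeling with label `2` at the minimum and label `1` everywhere else. -/
def bottomTwo (r s : ℕ) : Labeling (Rect r s) :=
  ⟨fun p => if p.1.val = 1 ∧ p.2.val = 1 then 2 else 1,
    fun p => by dsimp only; split_ifs <;> norm_num⟩

theorem invEntry_bottomTwo {t c : ℕ} (ht : t < r) (hc : c < s) :
    invEntry (bottomTwo r s) t c = if t = 0 ∧ c = 0 then 2⁻¹ else 1 := by
  rw [invEntry, entry, dif_pos ⟨⟨by omega, by omega⟩, ⟨by omega, by omega⟩⟩]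
  simp only [bottomTwo, Nat.add_eq_right]
  split_ifs <;> simp

theorem minorRatio_bottomTwo_zero (hr : 1 ≤ r) (hs : 1 ≤ s) :
    minorRatio r s (invEntry (bottomTwo r s)) 0 0 0 = 2 := by
  rw [minorRatio, rectMinor_size_zero, rectMinor_first hr hs]
  simp [invEntry_bottomTwo (show 0 < r by omega) (show 0 < s by omega)]

/-- The labels at the minimum are the parallel sums of `x` over the antidiagonals; only the first of
them contains the minimum. -/
theorem minorRatio_bottomTwo_le_one {k : ℕ} (hk : 1 ≤ k) (hr : 1 ≤ r) (hs : 1 ≤ s)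
    (h : k + 2 ≤ r + s) : minorRatio r s (invEntry (bottomTwo r s)) k 0 0 ≤ 1 := by
  have h1 : rectMinor r s (invEntry (bottomTwo r s)) 1 k 1
      = ∑ u ∈ range r, rectWeight s (invEntry (bottomTwo r s)) u k := by
    rw [rectMinor, solidMinor, Matrix.det_fin_one]
    simpa using stepMatrix_succ_right (rectWeight s (invEntry (bottomTwo r s))) r 0 k
  have h2 : (1 : ℝ) ≤ rectMinor r s (invEntry (bottomTwo r s)) 1 k 1 := by
    rw [h1]
    have h3 : rectWeight s (invEntry (bottomTwo r s)) (min k (r - 1)) k = 1 := by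
      rw [rectWeight, if_pos (by omega), invEntry_bottomTwo (by omega) (by omega),
        if_neg (by omega)]
    rw [← h3]
    exact Finset.single_le_sum (f := fun u => rectWeight s (invEntry (bottomTwo r s)) u k)
      (fun u _ => rectWeight_nonneg (invEntry_pos _) _ _) (Finset.mem_range.2 (by omega))
  rw [minorRatio, rectMinor_size_zero]
  exact (div_le_one (by linarith)).2 h2

theorem orderOf_rowmotion (L : LinExt (Rect r s)) (hr : 1 ≤ r) (hs : 1 ≤ s) :
    orderOf (rowmotion L) = r + s := by
  have hperiod : rowmotion L ^ (r + s) = 1 := by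
    refine Equiv.ext fun y => ?_
    obtain ⟨x, rfl⟩ := transfer.symm.surjective y
    have h := rowmotion_zpow L hr x ((r + s : ℕ) : ℤ)
    rw [zpow_natCast] at h
    rw [h, ← zero_sub, orbit_add_period, orbit_zero]
    rfl
  have key : ∀ m : ℕ, m < r + s → rowmotion L ^ m = 1 →
      orbitLabel r s (invEntry (bottomTwo r s)) m 0 0 = 2 := by
    intro m hm h
    have h1 := rowmotion_zpow L hr (bottomTwo r s) (-(m : ℤ))
    rw [zpow_neg, zpow_natCast, h, inv_one, neg_neg, ← orbit_zero hr, Equiv.Perm.one_apply] at h1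
    have h2 := congrFun (congrArg Subtype.val h1)
      (⟨⟨1, le_rfl, hr⟩, ⟨1, le_rfl, hs⟩⟩ : Rect r s)
    rw [orbit_apply hr _ (l := 0) (by simp), orbit_apply hr _ (l := m)
      (by rw [← Int.natCast_mod, Nat.mod_eq_of_lt hm]), orbitLabel_of_le (by simp; omega)] at h2
    rw [← minorRatio_bottomTwo_zero hr hs]
    exact h2.symm
  have small : ∀ m : ℕ, 0 < m → m + 2 ≤ r + s → rowmotion L ^ m ≠ 1 := by
    intro m h0 hm h
    have h1 := key m (by omega) h
    rw [orbitLabel_of_le (by omega)] at h1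
    have h2 := minorRatio_bottomTwo_le_one h0 hr hs hm
    linarith
  rw [orderOf_eq_iff (by omega)]
  refine ⟨hperiod, fun m hm h0 h => ?_⟩
  rcases Nat.lt_or_ge (m + 1) (r + s) with h1 | h1
  · exact small m h0 h1 h
  · -- Two consecutive powers of rowmotion would be trivial.
    have h2 : rowmotion L ^ 1 = 1 := by
      have h3 := hperiod
      rw [show r + s = m + 1 by omega, pow_add, h, one_mul] at h3
      exact h3
    rcases Nat.lt_or_ge 2 (r + s) with h3 | h3
    · exact small 1 one_pos h3 h2
    · have h4 := key 1 (by omega) h2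
      rw [orbitLabel_eq_inv (l := 0) (i' := 0) (j' := 0) (by omega) (by omega) (by omega),
        minorRatio_bottomTwo_zero hr hs] at h4
      norm_num at h4

end Order

end BiRow

theorem mainTheorem1 (r s : ℕ) (hr : 1 ≤ r) (hs : 1 ≤ s) (L : LinExt (Rect r s)) :
    (∀ (x y : Labeling (Rect r s)), y = transfer.symm x →
      -- `W` is the array of solid minors of the matrix of path weights
      (∀ k i j : ℕ, W x k i j
          = Matrix.det (Matrix.of fun a b : Fin k => W x 1 (i + a) (j + b))) ∧
      -- `W` satisfies the octahedron recurrence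
      (∀ k i j : ℕ, W x (k + 1) i j * W x (k + 1) (i + 1) (j + 1)
          = W x (k + 1) i (j + 1) * W x (k + 1) (i + 1) j
            + W x (k + 2) i j * W x k (i + 1) (j + 1)) ∧
      -- part (a)
      (∀ (p : Rect r s) (i j : ℕ), i = p.1 → j = p.2 → ∀ k : ℕ, k + i + j ≤ r + s →
        ((rowmotion L ^ (-(k : ℤ))) y).val p
          = W x (j - 1) (k + 2) (i + k + 1) / W x j (k + 1) (i + k + 1)) ∧
      -- part (b)
      (∀ (p : Rect r s) (i j : ℕ), i = p.1 → j = p.2 →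
        (∀ k : ℤ, ((rowmotion L ^ k) y).val p
          = 1 / ((rowmotion L ^ (k - i - j + 1)) y).val (antipode p)) ∧
        -- the right-hand side for `0 < k < i + j`, computed by part (a)
        (∀ k : ℕ, 0 < k → k < i + j →
          ((rowmotion L ^ (k : ℤ)) y).val p
            = 1 / (W x (s - j) (i + j - k + 1) (r + j + 1 - k)
                / W x (s + 1 - j) (i + j - k) (r + j + 1 - k)))) ∧
      -- part (c)
      (∀ k : ℤ, (rowmotion L ^ (k + r + s)) y = (rowmotion L ^ k) y)) ∧
    -- part (c): the order is `r + s`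
    orderOf (rowmotion L) = r + s := by
  refine ⟨?_, orderOf_rowmotion L hr hs⟩
  rintro x _ rfl
  have hb : ∀ (p : Rect r s) (k : ℤ), ((rowmotion L ^ k) (transfer.symm x)).val p
      = 1 / ((rowmotion L ^ (k - p.1.val - p.2.val + 1)) (transfer.symm x)).val (antipode p) := by
    intro p k
    rw [rowmotion_zpow L hr, rowmotion_zpow L hr, orbit_antipode,
      show -(k - p.1.val - p.2.val + 1) = -k + p.1.val + p.2.val - 1 by ring]
  refine ⟨W_eq_solidMinor hs x, fun k i j => ?_, ?_, ?_, fun k => ?_⟩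
  · simp only [W_eq_solidMinor hs x (k + 1), W_eq_solidMinor hs x (k + 2), W_eq_solidMinor hs x k]
    exact solidMinor_octahedron _ _ _ _
  · rintro p _ _ rfl rfl k hk
    rw [rowmotion_zpow L hr, neg_neg, orbit_natCast hr hs x p hk]
  · rintro p _ _ rfl rfl
    refine ⟨hb p, fun k hk0 hk => ?_⟩
    have hi := Set.mem_Icc.1 p.1.2
    have hj := Set.mem_Icc.1 p.2.2
    rw [hb, rowmotion_zpow L hr,
      show -((k : ℤ) - p.1.val - p.2.val + 1) = ((p.1.val + p.2.val - 1 - k : ℕ) : ℤ) by omega,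
      orbit_natCast hr hs x _ (by simp only [antipode]; omega)]
    simp only [antipode]
    congr 3 <;> omega
  · rw [rowmotion_zpow L hr, rowmotion_zpow L hr, ← orbit_add_period hr x (-k)]
    congr 1
    push_cast
    ring
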